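/- Consider a stochastic shortest path problem (undiscounted Markov decision problem) with finite set $S$ of non-terminal states, a trap terminal state $0$ of zero cost, finite action set $A$, transition probabilities $P_{ij}(a)\ge 0$ with $\sum_{j\in S}P_{ij}(a)\le 1$ and $P_{i0}(a)=1-\sum_{j\in S}P_{ij}(a)$, and stage cost $g:S\times A\to\mathbb{R}$. A policy is a map $\mu:S\to A$; $J^\mu(i)=\mathbb{E}\big[\sum_{k\ge 0} g(s_k,\mu(s_k))\mid s_0=i\big]$ is its expected cumulative cost, with $(s_k)$ the Markov chain controlled by $\mu$, and $J^*(i)=\min_\mu J^\mu(i)$. Assume that every policy is proper: from every initial state the terminal state is reached with probability $1$. Let $p(i)>0$, $i\in S$, with $\sum_{i\in S}p(i)=1$. Asynchronous optimistic policy iteration (MCES) generates a sequence $J_t\in\mathbb{R}^S$, $t\ge 0$, from an arbitrary (possibly random) initial vector $J_0$ as follows. Let $\mathcal{F}_t$ be a filtration describing the past. At iteration $t$ take an $\mathcal{F}_t$-measurable greedy policy $\mu_t$ for $J_t$, i.e. for all $i\in S$, $$g(i,\mu_t(i))+\sum_{j\in S}P_{ij}(\mu_t(i))J_t(j)=\min_{a\in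 A}\Big[g(i,a)+\sum_{j\in S}P_{ij}(a)J_t(j)\Big];$$ conditionally on $\mathcal{F}_t$, select a single state, state $i$ being selected with probability $p(i)$, and simulate from the selected state $i$ a trajectory of the chain controlled by $\mu_t$. Write the observed cumulative cost of the trajectory as $J^{\mu_t}(i)+w_t(i)$. Then $$J_{t+1}(i)=(1-\gamma_t(i))J_t(i)+\gamma_t(i)\big(J^{\mu_t}(i)+w_t(i)\big)$$ for the selected state $i$, and $J_{t+1}(j)=J_t(j)$ for every other state $j$. Then $J_t\to J^*$ almost surely under each of the following two choices of stepsizes: 1. $\gamma_t(i)=1/n_i(t)$, where $n_i(t)$ is the number of iterations among $0,1,\dots,t$ at which state $i$ is selected; 2. $\gamma_t(i)=\hat\gamma_t/p(i)$, where $(\hat\gamma_t)_{t\ge 0}$ is any deterministic sequence with $\hat\gamma_t\ge 0$, $\sum_{t}\hat\gamma_t=\infty$ and $\sum_{t}\hat\gamma_t^2<\infty$. -/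

import Mathlib

open MeasureTheory ProbabilityTheory Filter Topology

/-- A stochastic shortest path problem with finite state set `S` (the terminal state excluded) and
finite action set `A`: substochastic transition probabilities `P i a j` between non-terminal states
and a stage cost `g`. The missing mass `1 - ∑ j, P i a j` is the probability of moving from `i` to
the terminal state. -/
structure SSP (S A : Type*) [Fintype S] where
  P : S → A → S → ℝ
  P_nonneg : ∀ i a j, 0 ≤ P i a j
  P_sum_le_one : ∀ i a, ∑ j, P i a j ≤ 1
  g : S → A → ℝ

/-- The state space together with the terminal state `none` carries the discrete σ-algebra. -/
instance SSP.instMeasurableSpaceOption {S : Type*} : MeasurableSpace (Option S) := ⊤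

instance SSP.instDiscreteMeasurableSpaceOption {S : Type*} :
    DiscreteMeasurableSpace (Option S) := ⟨fun _ => trivial⟩

namespace SSP

/-- One-step transition weights out of the non-terminal state `i` under action `a`. -/
noncomputable def stepWeight {S A : Type*} [Fintype S] (M : SSP S A) (i : S) (a : A) :
    Option S → ENNReal
  | none => ENNReal.ofReal (1 - ∑ j, M.P i a j)
  | some j => ENNReal.ofReal (M.P i a j)

theorem sum_stepWeight {S A : Type*} [Fintype S] (M : SSP S A) (i : S) (a : A) :
    ∑ x, M.stepWeight i a x = 1 := by
  rw [Fintype.sum_option]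
  simp only [stepWeight]
  rw [← ENNReal.ofReal_sum_of_nonneg (fun j _ => M.P_nonneg i a j),
    ← ENNReal.ofReal_add (sub_nonneg.2 (M.P_sum_le_one i a))
      (Finset.sum_nonneg fun j _ => M.P_nonneg i a j)]
  simp

/-- One-step transition law of the chain controlled by the policy `π`; the terminal state `none`
is a trap. -/
noncomputable def stepLaw {S A : Type*} [Fintype S] (M : SSP S A) (π : S → A) :
    Option S → PMF (Option S)
  | none => PMF.pure none
  | some i => PMF.ofFintype (M.stepWeight i (π i)) (M.sum_stepWeight i (π i))

/-- The transition kernel at time `k` as a kernel on histories: it reads only the current state. -/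
noncomputable def histKernel {S A : Type*} [Fintype S] (M : SSP S A) (π : S → A) (k : ℕ) :
    Kernel (Π _ : Finset.Iic k, Option S) (Option S) where
  toFun h := (M.stepLaw π (h ⟨k, Finset.mem_Iic.2 le_rfl⟩)).toMeasure
  measurable' := measurable_of_countable _

instance {S A : Type*} [Fintype S] (M : SSP S A) (π : S → A) (k : ℕ) :
    IsMarkovKernel (M.histKernel π k) :=
  ⟨fun h => inferInstanceAs
    (IsProbabilityMeasure (M.stepLaw π (h ⟨k, Finset.mem_Iic.2 le_rfl⟩)).toMeasure)⟩

/-- The law on state sequences `s₀, s₁, …` of the Markov chain started at `s₀ = i` and controlled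
by the policy `π`. -/
noncomputable def chainLaw {S A : Type*} [Fintype S] (M : SSP S A) (π : S → A) (i : S) :
    Measure (ℕ → Option S) :=
  Kernel.traj (X := fun _ => Option S) (M.histKernel π) 0 (fun _ => some i)

/-- A policy is proper if the terminal state is reached with probability one from every state. -/
def IsProper {S A : Type*} [Fintype S] (M : SSP S A) (π : S → A) : Prop :=
  ∀ i : S, ∀ᵐ s ∂(M.chainLaw π i), ∃ k, s k = none

/-- Stage cost of a policy, extended by `0` to the terminal state. -/
def stageCost {S A : Type*} [Fintype S] (M : SSP S A) (π : S → A) : Option S → ℝ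
  | none => 0
  | some i => M.g i (π i)

/-- Cumulative (undiscounted) cost observed along a state trajectory under the policy `π`. -/
noncomputable def observedCost {S A : Type*} [Fintype S] (M : SSP S A) (π : S → A)
    (s : ℕ → Option S) : ℝ :=
  ∑' k, M.stageCost π (s k)

/-- Cost-to-go `J^π(i)`: the expected cumulative cost of `π` from the state `i`. -/
noncomputable def costToGo {S A : Type*} [Fintype S] (M : SSP S A) (π : S → A) (i : S) : ℝ :=
  ∫ s, M.observedCost π s ∂(M.chainLaw π i)

/-- Optimal cost-to-go `J*(i)`, the minimum of `J^π(i)` over the finitely many policies. -/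
noncomputable def optCost {S A : Type*} [Fintype S] (M : SSP S A) (i : S) : ℝ :=
  ⨅ π : S → A, M.costToGo π i

/-- The dynamic programming operator `T_π` of a policy. -/
def bellmanPolicy {S A : Type*} [Fintype S] (M : SSP S A) (π : S → A) (J : S → ℝ) : S → ℝ :=
  fun i => M.g i (π i) + ∑ j, M.P i (π i) j * J j

/-- The dynamic programming operator `T` (a minimum over the finitely many actions). -/
noncomputable def bellman {S A : Type*} [Fintype S] (M : SSP S A) (J : S → ℝ) : S → ℝ :=
  fun i => ⨅ a : A, (M.g i a + ∑ j, M.P i a j * J j)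

/-- `n_i(t)`: the number of iterations `0, …, t` at which the state `i` was selected. -/
def selectionCount {S Ω : Type*} [DecidableEq S] (sel : ℕ → Ω → S) (t : ℕ) (ω : Ω) (i : S) : ℕ :=
  ((Finset.range (t + 1)).filter fun r => sel r ω = i).card

/-- A run of asynchronous optimistic policy iteration with Monte Carlo evaluation (MCES).
At iteration `t`, given the past `ℱ t`, the greedy policy `pol t` for the current values `J t` is
fixed, a state `sel t` is selected with law `p`, independently of the past, a trajectory `traj t`
of the chain controlled by `pol t` is simulated from it, and the value of the selected state is
moved towards the observed cumulative cost with stepsize `step t`. -/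
structure IsMCES {S A Ω : Type*} [Fintype S] [DecidableEq S] {m : MeasurableSpace Ω}
    (M : SSP S A) (p : S → ℝ) (Pr : Measure Ω) (ℱ : Filtration ℕ m)
    (J : ℕ → Ω → S → ℝ) (pol : ℕ → Ω → S → A) (sel : ℕ → Ω → S)
    (traj : ℕ → Ω → ℕ → Option S) (step : ℕ → Ω → S → ℝ) : Prop where
  init_measurable : Measurable[ℱ 0] (J 0)
  pol_measurable : ∀ t π, MeasurableSet[ℱ t] {ω | pol t ω = π}
  sel_measurable : ∀ t i, MeasurableSet[ℱ (t + 1)] {ω | sel t ω = i}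
  traj_measurable : ∀ t, Measurable[ℱ (t + 1)] (traj t)
  greedy : ∀ t ω, M.bellmanPolicy (pol t ω) (J t ω) = M.bellman (J t ω)
  /-- Conditional law of the selected state and of the simulated trajectory, given the past. -/
  sample : ∀ t (F : Set Ω), MeasurableSet[ℱ t] F → ∀ (π : S → A) (i : S)
    (B : Set (ℕ → Option S)), MeasurableSet B →
      Pr (F ∩ {ω | pol t ω = π ∧ sel t ω = i ∧ traj t ω ∈ B}) =
        Pr (F ∩ {ω | pol t ω = π}) * ENNReal.ofReal (p i) * M.chainLaw π i B
  /-- The observed cost is `J^μ(i) + w(i)` with `μ = pol t ω` and `w` the simulation noise. -/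
  update : ∀ t ω i, J (t + 1) ω i =
    if sel t ω = i then
      (1 - step t ω i) * J t ω i + step t ω i * M.observedCost (pol t ω) (traj t ω)
    else J t ω i

end SSP

/-! The argument separates a pathwise deterministic recursion from the probability needed to produce
it.

Along one path, suppose `J (t+1) = (1 - γ t) J t + γ t (J^μ + r t) + e t` with `μ` greedy for `J t`,
`r → 0`, and the series of `e` convergent along each policy. As `T_μ` is affine, agrees with `T` at
`J t` and fixes `J^μ`, the residual `T J - J` satisfies a scalar averaging inequality with targets
tending to `0`. So it is asymptotically nonpositive (`eventually_bellman_sub_le`). A residual of at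
most `c` gives `J^μ ≤ T J + O(c)` (`costToGo_greedy_le`). Since `T J ≤ T_π J`, the excess `J - J^π`
is averaged towards targets that are at most `P_π (J - J^π)` up to a small error. Iterating, its
limsup is at most `P_π^n C` for every `n`, which tends to `0` by properness. This gives `limsup J ≤
J^π` for all `π`. The lower bound is immediate because every target satisfies `J^μ ≥ J*`.

The required uniformity comes from a weight `ξ` that drops by `1/2` in expectation under every
action (`exists_weight`). It also gives geometric survival tails, hence the Bellman equation and
square-integrable observed costs.

The random recursion is the deterministic one with every state moved by its conditional mean step `p
i * c`, plus martingale differences, where `c` is a predictable version of the stepsize. `L²`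
martingale convergence handles the noise, once the iterates are known to be almost surely bounded.
For stepsizes `1/n_i`, the law of large numbers shows `p i * c` is asymptotically `1/(t+1)` for all
states, so they share a common `γ`. -/

/-! ### Scalar stochastic approximation along one path. -/

theorem tendsto_prod_one_sub_zero {γ : ℕ → ℝ} (h1 : ∀ t, γ t ≤ 1)
    (hγ : Tendsto (fun N => ∑ t ∈ Finset.range N, γ t) atTop atTop) :
    Tendsto (fun N => ∏ t ∈ Finset.range N, (1 - γ t)) atTop (𝓝 0) := by
  have hexp : Tendsto (fun N => Real.exp (-∑ t ∈ Finset.range N, γ t)) atTop (𝓝 0) :=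
    Real.tendsto_exp_neg_atTop_nhds_zero.comp hγ
  refine squeeze_zero (fun N => Finset.prod_nonneg fun t _ => sub_nonneg.2 (h1 t)) (fun N => ?_) hexp
  rw [← Finset.sum_neg_distrib, Real.exp_sum]
  refine Finset.prod_le_prod (fun t _ => sub_nonneg.2 (h1 t)) fun t _ => ?_
  linarith [Real.add_one_le_exp (-γ t)]

theorem le_prod_mul_of_le_one_sub_mul {γ z : ℕ → ℝ} (h1 : ∀ t, γ t ≤ 1)
    (hz : ∀ t, z (t + 1) ≤ (1 - γ t) * z t) (N : ℕ) :
    z N ≤ (∏ t ∈ Finset.range N, (1 - γ t)) * z 0 := by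
  induction N with
  | zero => simp
  | succ n ih =>
    rw [Finset.prod_range_succ, mul_comm (∏ t ∈ Finset.range n, (1 - γ t)), mul_assoc]
    exact (hz n).trans (mul_le_mul_of_nonneg_left ih (sub_nonneg.2 (h1 n)))

theorem tendsto_sum_range_add_atTop {γ : ℕ → ℝ}
    (hγ : Tendsto (fun N => ∑ t ∈ Finset.range N, γ t) atTop atTop) (T : ℕ) :
    Tendsto (fun N => ∑ t ∈ Finset.range N, γ (T + t)) atTop atTop := by
  have h : (fun N => ∑ t ∈ Finset.range N, γ (T + t)) =
      fun N => (∑ t ∈ Finset.range (N + T), γ t) - ∑ t ∈ Finset.range T, γ t := by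
    funext N
    rw [add_comm N T, Finset.sum_range_add]
    ring
  rw [h]
  simp only [sub_eq_add_neg]
  exact tendsto_atTop_add_const_right _ _ (hγ.comp (tendsto_add_atTop_nat T))

/-- Scalar stochastic approximation along one path: if `x` is moved towards targets `b t` that are
asymptotically at most `b`, up to a perturbation with convergent partial sums, then `x` is
asymptotically at most `b`. -/
theorem eventually_le_of_stochastic_approx {γ x b e : ℕ → ℝ} {B l : ℝ}
    (h0 : ∀ t, 0 ≤ γ t) (hγ0 : Tendsto γ atTop (𝓝 0))
    (hγ : Tendsto (fun N => ∑ t ∈ Finset.range N, γ t) atTop atTop)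
    (hx : ∀ t, x (t + 1) ≤ (1 - γ t) * x t + γ t * b t + e t)
    (he : Tendsto (fun N => ∑ t ∈ Finset.range N, e t) atTop (𝓝 l))
    (hb : ∀ ε > 0, ∀ᶠ t in atTop, b t ≤ B + ε) :
    ∀ ε > 0, ∀ᶠ t in atTop, x t ≤ B + ε := by
  intro ε hε
  -- Adding the tail `E` of the perturbation absorbs `e`: `x + E` obeys the unperturbed recursion
  -- with target `b + E`, and `E → 0`.
  set E : ℕ → ℝ := fun t => l - ∑ s ∈ Finset.range t, e s with hE
  have hE0 : Tendsto E atTop (𝓝 0) := by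
    simpa using (tendsto_const_nhds (x := l)).sub he
  have hEs : ∀ t, E (t + 1) = E t - e t := fun t => by
    simp only [hE, Finset.sum_range_succ]; ring
  have hsmall : ∀ᶠ t in atTop, |E t| < ε / 4 := by
    have := hE0.abs
    rw [abs_zero] at this
    exact this.eventually_lt_const (by positivity)
  obtain ⟨T, hT⟩ := eventually_atTop.1
    ((hsmall.and (hb (ε / 4) (by positivity))).and (hγ0.eventually_lt_const one_pos))
  set z : ℕ → ℝ := fun t => x (T + t) + E (T + t) - (B + ε / 2) with hz
  have hstep : ∀ t, z (t + 1) ≤ (1 - γ (T + t)) * z t := by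
    intro t
    obtain ⟨⟨hE1, hb1⟩, hg1⟩ := hT (T + t) (Nat.le_add_right _ _)
    have h1 := hx (T + t)
    have h2 := hEs (T + t)
    have h3 : γ (T + t) * (b (T + t) + E (T + t)) ≤ γ (T + t) * (B + ε / 2) :=
      mul_le_mul_of_nonneg_left (by linarith [(abs_lt.1 hE1).2]) (h0 _)
    simp only [hz, ← add_assoc] at *
    rw [h2]
    linarith
  have hle := le_prod_mul_of_le_one_sub_mul (γ := fun t => γ (T + t))
    (fun t => (hT (T + t) (Nat.le_add_right _ _)).2.le) hstep
  have hlim : Tendsto (fun N => (∏ t ∈ Finset.range N, (1 - γ (T + t))) * z 0) atTop (𝓝 0) := by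
    simpa using (tendsto_prod_one_sub_zero (γ := fun t => γ (T + t))
      (fun t => (hT (T + t) (Nat.le_add_right _ _)).2.le)
      (tendsto_sum_range_add_atTop hγ T)).mul_const (z 0)
  obtain ⟨N, hN⟩ := eventually_atTop.1 (hlim.eventually_lt_const (show (0 : ℝ) < ε / 4 by positivity))
  filter_upwards [eventually_ge_atTop (T + N)] with t ht
  obtain ⟨k, rfl⟩ := Nat.exists_eq_add_of_le (le_trans (Nat.le_add_right T N) ht)
  have h1 := (hle k).trans_lt (hN k (by omega))
  have h2 := (abs_lt.1 (hT (T + k) (Nat.le_add_right _ _)).1.1).1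
  simp only [hz] at h1
  linarith

theorem eventually_ge_of_stochastic_approx {γ x b e : ℕ → ℝ} {B l : ℝ}
    (h0 : ∀ t, 0 ≤ γ t) (hγ0 : Tendsto γ atTop (𝓝 0))
    (hγ : Tendsto (fun N => ∑ t ∈ Finset.range N, γ t) atTop atTop)
    (hx : ∀ t, (1 - γ t) * x t + γ t * b t + e t ≤ x (t + 1))
    (he : Tendsto (fun N => ∑ t ∈ Finset.range N, e t) atTop (𝓝 l))
    (hb : ∀ ε > 0, ∀ᶠ t in atTop, B - ε ≤ b t) :
    ∀ ε > 0, ∀ᶠ t in atTop, B - ε ≤ x t := by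
  intro ε hε
  have := eventually_le_of_stochastic_approx (x := fun t => -x t) (b := fun t => -b t)
    (e := fun t => -e t) (B := -B) (l := -l) h0 hγ0 hγ (fun t => by linarith [hx t])
    (by simpa using he.neg) (fun ε hε => (hb ε hε).mono fun t ht => by linarith) ε hε
  exact this.mono fun t ht => by linarith

theorem tendsto_of_stochastic_approx {γ x b e : ℕ → ℝ} {B l : ℝ}
    (h0 : ∀ t, 0 ≤ γ t) (hγ0 : Tendsto γ atTop (𝓝 0))
    (hγ : Tendsto (fun N => ∑ t ∈ Finset.range N, γ t) atTop atTop)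
    (hx : ∀ t, x (t + 1) = (1 - γ t) * x t + γ t * b t + e t)
    (he : Tendsto (fun N => ∑ t ∈ Finset.range N, e t) atTop (𝓝 l))
    (hb : Tendsto b atTop (𝓝 B)) : Tendsto x atTop (𝓝 B) := by
  rw [tendsto_order]
  refine ⟨fun a ha => ?_, fun a ha => ?_⟩
  · filter_upwards [eventually_ge_of_stochastic_approx (B := B) h0 hγ0 hγ (fun t => (hx t).ge) he
      (fun ε hε => hb.eventually_const_le (by linarith)) ((B - a) / 2) (by linarith)] with t ht
    linarith
  · filter_upwards [eventually_le_of_stochastic_approx (B := B) h0 hγ0 hγ (fun t => (hx t).le) he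
      (fun ε hε => hb.eventually_le_const (by linarith)) ((a - B) / 2) (by linarith)] with t ht
    linarith

theorem exists_forall_abs_le_of_eventually {x : ℕ → ℝ} {C : ℝ} {T : ℕ}
    (h : ∀ t, T ≤ t → |x t| ≤ C) : ∃ K : ℝ, ∀ t, |x t| ≤ K := by
  refine ⟨C + ∑ s ∈ Finset.range T, |x s|, fun t => ?_⟩
  rcases le_or_gt T t with ht | ht
  · exact (h t ht).trans (le_add_of_nonneg_right (Finset.sum_nonneg fun _ _ => abs_nonneg _))
  · have hC : 0 ≤ C := (abs_nonneg _).trans (h T le_rfl)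
    have := Finset.single_le_sum (f := fun s => |x s|) (fun s _ => abs_nonneg _)
      (Finset.mem_range.2 ht)
    linarith

/-- Once `a ≤ 1`, `x` plus the tail of the perturbation series moves by convex combinations towards
bounded targets. Divergence of `∑ a` plays no role, so `a` may vanish whenever a state is not
selected. -/
theorem bounded_of_stochastic_approx {a x b e : ℕ → ℝ} {C l : ℝ}
    (h0 : ∀ t, 0 ≤ a t) (ha : ∀ᶠ t in atTop, a t ≤ 1)
    (hx : ∀ t, x (t + 1) = (1 - a t) * x t + a t * b t + e t)
    (he : Tendsto (fun N => ∑ t ∈ Finset.range N, e t) atTop (𝓝 l))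
    (hb : ∀ t, |b t| ≤ C) : ∃ K : ℝ, ∀ t, |x t| ≤ K := by
  set E : ℕ → ℝ := fun t => l - ∑ s ∈ Finset.range t, e s with hE
  have hE0 : Tendsto E atTop (𝓝 0) := by
    simpa using (tendsto_const_nhds (x := l)).sub he
  have hEs : ∀ t, E (t + 1) = E t - e t := fun t => by
    simp only [hE, Finset.sum_range_succ]; ring
  have hsmall : ∀ᶠ t in atTop, |E t| < 1 := by
    have := hE0.abs
    rw [abs_zero] at this
    exact this.eventually_lt_const one_pos
  obtain ⟨T, hT⟩ := eventually_atTop.1 (hsmall.and ha)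
  have key : ∀ t, |x (T + t) + E (T + t)| ≤ max |x T + E T| (C + 1) := by
    intro t
    induction t with
    | zero => exact le_max_left _ _
    | succ t ih =>
      obtain ⟨hE1, ha1⟩ := hT (T + t) (Nat.le_add_right _ _)
      have heq : x (T + (t + 1)) + E (T + (t + 1)) =
          (1 - a (T + t)) * (x (T + t) + E (T + t)) + a (T + t) * (b (T + t) + E (T + t)) := by
        rw [← add_assoc, hx, hEs]; ring
      have hbE : |b (T + t) + E (T + t)| ≤ max |x T + E T| (C + 1) :=
        (abs_add_le _ _).trans ((add_le_add (hb _) hE1.le).trans (le_max_right _ _))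
      rw [heq]
      refine (abs_add_le _ _).trans ?_
      rw [abs_mul, abs_mul, abs_of_nonneg (sub_nonneg.2 ha1), abs_of_nonneg (h0 _)]
      nlinarith [mul_le_mul_of_nonneg_left ih (sub_nonneg.2 ha1),
        mul_le_mul_of_nonneg_left hbE (h0 (T + t))]
  refine exists_forall_abs_le_of_eventually (C := max |x T + E T| (C + 1) + 1) (T := T)
    fun t ht => ?_
  obtain ⟨k, rfl⟩ := Nat.exists_eq_add_of_le ht
  have h1 := key k
  have h2 := (hT (T + k) ht).1
  have : x (T + k) = (x (T + k) + E (T + k)) - E (T + k) := by ring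
  rw [this]
  exact (abs_sub _ _).trans (by linarith)

/-! ### Law of the controlled chain and powers of its transition matrix. -/

namespace SSP
variable {S A : Type*} [Fintype S]

instance (M : SSP S A) (π : S → A) (i : S) : IsProbabilityMeasure (M.chainLaw π i) := by
  unfold chainLaw; infer_instance

/-- The Markov property of the controlled chain, one step ahead. -/
theorem lintegral_chainLaw_succ (M : SSP S A) (π : S → A) (i : S) (n : ℕ)
    (f : Option S → Option S → ENNReal) :
    ∫⁻ s, f (s n) (s (n + 1)) ∂(M.chainLaw π i) =
      ∫⁻ s, ∫⁻ y, f (s n) y ∂(M.stepLaw π (s n)).toMeasure ∂(M.chainLaw π i) := by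
  have hm : Measurable fun h : Π _ : Finset.Iic (n + 1), Option S =>
      f (h ⟨n, Finset.mem_Iic.2 n.le_succ⟩) (h ⟨n + 1, Finset.mem_Iic.2 le_rfl⟩) :=
    measurable_of_countable _
  have hm' : Measurable fun h : Π _ : Finset.Iic n, Option S =>
      ∫⁻ y, f (h ⟨n, Finset.mem_Iic.2 le_rfl⟩) y
        ∂(M.stepLaw π (h ⟨n, Finset.mem_Iic.2 le_rfl⟩)).toMeasure := measurable_of_countable _
  -- Both integrands depend on finitely many coordinates, so they can be integrated over finite
  -- histories, where the law is an explicit composition of kernels.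
  have h1 : ∫⁻ s, f (s n) (s (n + 1)) ∂(M.chainLaw π i) =
      ∫⁻ h, f (h ⟨n, Finset.mem_Iic.2 n.le_succ⟩) (h ⟨n + 1, Finset.mem_Iic.2 le_rfl⟩)
        ∂((M.chainLaw π i).map (Preorder.frestrictLe (n + 1))) := by
    rw [lintegral_map hm (Preorder.measurable_frestrictLe _)]
    rfl
  have h2 : ∫⁻ s, ∫⁻ y, f (s n) y ∂(M.stepLaw π (s n)).toMeasure ∂(M.chainLaw π i) =
      ∫⁻ h, ∫⁻ y, f (h ⟨n, Finset.mem_Iic.2 le_rfl⟩) y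
        ∂(M.stepLaw π (h ⟨n, Finset.mem_Iic.2 le_rfl⟩)).toMeasure
        ∂((M.chainLaw π i).map (Preorder.frestrictLe n)) := by
    rw [lintegral_map hm' (Preorder.measurable_frestrictLe _)]
    rfl
  rw [h1, h2, chainLaw, Kernel.traj_map_frestrictLe_apply, Kernel.traj_map_frestrictLe_apply,
    Kernel.partialTraj_succ_of_le (Nat.zero_le n), Kernel.lintegral_map _ (by fun_prop) _ hm,
    Kernel.lintegral_comp _ _ _ (measurable_of_countable _)]
  refine lintegral_congr fun h => ?_
  rw [Kernel.lintegral_id_prod (measurable_of_countable _),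
    Kernel.lintegral_map _ (MeasurableEquiv.measurable _) _ (measurable_of_countable _)]
  refine lintegral_congr fun y => ?_
  simp [IicProdIoc_def, MeasurableEquiv.piSingleton]

/-- The policy-controlled transition matrix, acting on functions on the non-terminal states. -/
noncomputable def transOp (M : SSP S A) (π : S → A) : (S → ℝ) →ₗ[ℝ] (S → ℝ) where
  toFun v i := ∑ j, M.P i (π i) j * v j
  map_add' v w := by ext i; simp [mul_add, Finset.sum_add_distrib]
  map_smul' c v := by ext i; simp [Finset.mul_sum, mul_left_comm]

theorem transOp_apply (M : SSP S A) (π : S → A) (v : S → ℝ) (i : S) :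
    M.transOp π v i = ∑ j, M.P i (π i) j * v j := rfl

theorem bellmanPolicy_eq (M : SSP S A) (π : S → A) (v : S → ℝ) :
    M.bellmanPolicy π v = (fun i => M.g i (π i)) + M.transOp π v := rfl

theorem transOp_mono (M : SSP S A) (π : S → A) : Monotone (M.transOp π) := fun _ _ h i =>
  Finset.sum_le_sum fun j _ => mul_le_mul_of_nonneg_left (h j) (M.P_nonneg i _ j)

theorem transOp_pow_succ (M : SSP S A) (π : S → A) (n : ℕ) (v : S → ℝ) :
    (M.transOp π ^ (n + 1)) v = M.transOp π ((M.transOp π ^ n) v) := by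
  rw [pow_succ']; rfl

theorem transOp_pow_succ' (M : SSP S A) (π : S → A) (n : ℕ) (v : S → ℝ) :
    (M.transOp π ^ (n + 1)) v = (M.transOp π ^ n) (M.transOp π v) := by
  rw [pow_succ]; rfl

theorem transOp_pow_mono (M : SSP S A) (π : S → A) (n : ℕ) : Monotone ⇑(M.transOp π ^ n) := by
  induction n with
  | zero => exact monotone_id
  | succ n ih =>
    intro v w h
    rw [transOp_pow_succ, transOp_pow_succ]
    exact M.transOp_mono π (ih h)

theorem transOp_pow_nonneg (M : SSP S A) (π : S → A) (n : ℕ) {v : S → ℝ} (hv : 0 ≤ v) :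
    0 ≤ (M.transOp π ^ n) v := by
  simpa using M.transOp_pow_mono π n hv

/-- Extension of a function on the non-terminal states by `0` to the terminal state. -/
def extendZero {S : Type*} (v : S → ℝ) : Option S → ℝ := fun x => x.elim 0 v

theorem stageCost_eq (M : SSP S A) (π : S → A) :
    M.stageCost π = extendZero fun i => M.g i (π i) := by
  funext x; cases x <;> rfl

theorem lintegral_stepLaw (M : SSP S A) (π : S → A) {v : S → ℝ} (hv : 0 ≤ v) (x : Option S) :
    ∫⁻ y, ENNReal.ofReal (extendZero v y) ∂(M.stepLaw π x).toMeasure =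
      ENNReal.ofReal (extendZero (M.transOp π v) x) := by
  rw [lintegral_fintype]
  simp_rw [PMF.toMeasure_apply_singleton _ _ (measurableSet_singleton _)]
  rw [Fintype.sum_option]
  cases x with
  | none => simp [extendZero, stepLaw]
  | some i =>
    simp only [extendZero, stepLaw, PMF.ofFintype_apply, stepWeight, Option.elim]
    rw [transOp_apply, ENNReal.ofReal_sum_of_nonneg fun j _ => mul_nonneg (M.P_nonneg i _ j) (hv j)]
    simp only [ENNReal.ofReal_zero, zero_mul, zero_add]
    exact Finset.sum_congr rfl fun j _ => by
      rw [ENNReal.ofReal_mul (M.P_nonneg i _ j), mul_comm]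

theorem ae_chainLaw_zero (M : SSP S A) (π : S → A) (i : S) :
    ∀ᵐ s ∂(M.chainLaw π i), s 0 = some i := by
  have h : (M.chainLaw π i).map (Preorder.frestrictLe 0) =
      Measure.dirac (fun _ : Finset.Iic 0 => some i) := by
    rw [chainLaw, Kernel.traj_map_frestrictLe_apply, Kernel.partialTraj_self, Kernel.id_apply]
  have h2 : ∀ᵐ h : (Π _ : Finset.Iic 0, Option S) ∂((M.chainLaw π i).map (Preorder.frestrictLe 0)),
      h ⟨0, Finset.mem_Iic.2 le_rfl⟩ = some i := by
    rw [h, ae_dirac_eq]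
    rfl
  exact ae_of_ae_map (Preorder.measurable_frestrictLe 0).aemeasurable h2

/-- Conditioning on the state at time `n` replaces `v` at time `n + 1` by `P v` at time `n`; hence
the induction over all `v`. The zero extension accounts for the terminated mass. -/
theorem lintegral_chainLaw_eval (M : SSP S A) (π : S → A) (i : S) (n : ℕ) {v : S → ℝ}
    (hv : 0 ≤ v) :
    ∫⁻ s, ENNReal.ofReal (extendZero v (s n)) ∂(M.chainLaw π i) =
      ENNReal.ofReal ((M.transOp π ^ n) v i) := by
  induction n generalizing v with
  | zero =>
    rw [lintegral_congr_ae ((M.ae_chainLaw_zero π i).mono fun s hs => by simp only [hs]; rfl :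
      _ =ᵐ[_] fun _ => ENNReal.ofReal (v i))]
    simp
  | succ n ih =>
    rw [lintegral_chainLaw_succ M π i n fun _ y => ENNReal.ofReal (extendZero v y)]
    simp_rw [lintegral_stepLaw M π hv]
    rw [ih (by simpa using M.transOp_mono π hv), transOp_pow_succ']

theorem extendZero_nonneg {S : Type*} {v : S → ℝ} (hv : 0 ≤ v) (x : Option S) :
    0 ≤ extendZero v x := by
  cases x with
  | none => exact le_rfl
  | some i => exact hv i

theorem integrable_chainLaw_eval (M : SSP S A) (π : S → A) (i : S) (n : ℕ) (f : Option S → ℝ) :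
    Integrable (fun s : ℕ → Option S => f (s n)) (M.chainLaw π i) := by
  refine Integrable.of_bound (C := ∑ x, |f x|)
    ((measurable_of_countable f).comp (measurable_pi_apply n)).aestronglyMeasurable
    (ae_of_all _ fun s => ?_)
  exact Finset.single_le_sum (f := fun x => |f x|) (fun x _ => abs_nonneg _) (Finset.mem_univ (s n))

theorem integral_chainLaw_eval (M : SSP S A) (π : S → A) (i : S) (n : ℕ) (v : S → ℝ) :
    ∫ s, extendZero v (s n) ∂(M.chainLaw π i) = (M.transOp π ^ n) v i := by
  have hpos : ∀ w : S → ℝ, 0 ≤ w →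
      ∫ s, extendZero w (s n) ∂(M.chainLaw π i) = (M.transOp π ^ n) w i := fun w hw => by
    rw [integral_eq_lintegral_of_nonneg_ae (ae_of_all _ fun s => extendZero_nonneg hw _)
      (M.integrable_chainLaw_eval π i n _).aestronglyMeasurable, lintegral_chainLaw_eval M π i n hw,
      ENNReal.toReal_ofReal (M.transOp_pow_nonneg π n hw i)]
  have hv : v = v⁺ - v⁻ := (posPart_sub_negPart v).symm
  have hext : ∀ x, extendZero v x = extendZero v⁺ x - extendZero v⁻ x := fun x => by
    cases x with
    | none => simp [extendZero]
    | some i => exact congrFun hv i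
  simp_rw [hext]
  rw [integral_sub (M.integrable_chainLaw_eval π i n _) (M.integrable_chainLaw_eval π i n _),
    hpos _ (posPart_nonneg v), hpos _ (negPart_nonneg v)]
  conv_rhs => rw [hv, map_sub]
  rfl

/-- The terminal state is a trap. -/
theorem ae_chainLaw_trap (M : SSP S A) (π : S → A) (i : S) :
    ∀ᵐ s ∂(M.chainLaw π i), ∀ n, s n = none → s (n + 1) = none := by
  classical
  rw [ae_all_iff]
  intro n
  have h := M.lintegral_chainLaw_succ π i n fun x y => if x = none ∧ y ≠ none then 1 else 0
  have h0 : ∀ x, ∫⁻ y, (if x = none ∧ y ≠ none then 1 else 0 : ENNReal)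
      ∂(M.stepLaw π x).toMeasure = 0 := by
    intro x
    rw [lintegral_fintype]
    simp_rw [PMF.toMeasure_apply_singleton _ _ (measurableSet_singleton _)]
    cases x with
    | none => simp [stepLaw]
    | some i => simp
  simp_rw [h0] at h
  have hq : Measurable fun q : Option S × Option S =>
      (if q.1 = none ∧ q.2 ≠ none then 1 else 0 : ENNReal) := measurable_of_countable _
  have hs : Measurable fun s : ℕ → Option S => (s n, s (n + 1)) :=
    (measurable_pi_apply n).prodMk (measurable_pi_apply (n + 1))
  rw [lintegral_zero] at h
  filter_upwards [(lintegral_eq_zero_iff (hq.comp hs)).1 h] with s hs h1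
  by_contra h2
  simp [h1, h2] at hs

theorem ae_chainLaw_absorbed (M : SSP S A) {π : S → A} (hπ : M.IsProper π) (i : S) :
    ∀ᵐ s ∂(M.chainLaw π i), ∃ k, ∀ n, k ≤ n → s n = none := by
  filter_upwards [hπ i, M.ae_chainLaw_trap π i] with s ⟨k, hk⟩ ht
  refine ⟨k, fun n hn => ?_⟩
  induction n, hn using Nat.le_induction with
  | base => exact hk
  | succ n _ ih => exact ht n ih

/-- `P^n 1` is the probability of being alive at time `n`; absorption sends the indicator to `0`
almost surely, and dominated convergence applies. -/
theorem tendsto_transOp_pow_one (M : SSP S A) {π : S → A} (hπ : M.IsProper π) (i : S) :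
    Tendsto (fun n => (M.transOp π ^ n) 1 i) atTop (𝓝 0) := by
  simp_rw [← M.integral_chainLaw_eval π i]
  have : Tendsto (fun n => ∫ s, extendZero (1 : S → ℝ) (s n) ∂(M.chainLaw π i)) atTop
      (𝓝 (∫ _, (0 : ℝ) ∂(M.chainLaw π i))) := by
    refine tendsto_integral_of_dominated_convergence (fun _ => 1)
      (fun n => (M.integrable_chainLaw_eval π i n _).aestronglyMeasurable) (integrable_const _)
      (fun n => ae_of_all _ fun s => ?_) ?_
    · cases s n <;> simp [extendZero]
    · filter_upwards [M.ae_chainLaw_absorbed hπ i] with s ⟨k, hk⟩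
      refine tendsto_const_nhds.congr' ?_
      filter_upwards [eventually_ge_atTop k] with n hn
      rw [hk n hn]; rfl
  simpa using this

end SSP

/-! ### Maximum principle, uniform termination, Bellman equation and second moments. -/

namespace SSP
variable {S A : Type*} [Fintype S]

/-- Maximum principle: iterating gives `v ≤ P^n v ≤ C P^n 1 → 0`. -/
theorem eq_zero_of_le_transOp (M : SSP S A) {π : S → A} (hπ : M.IsProper π) {v : S → ℝ} {C : ℝ}
    (hC : ∀ i, v i ≤ C) (hv : v ≤ M.transOp π v) (i : S) : v i ≤ 0 := by
  have h1 : ∀ n, v ≤ (M.transOp π ^ n) v := by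
    intro n
    induction n with
    | zero => exact le_rfl
    | succ n ih =>
      rw [transOp_pow_succ]
      exact hv.trans (M.transOp_mono π ih)
  have hlim := (M.tendsto_transOp_pow_one hπ i).const_mul C
  rw [mul_zero] at hlim
  refine ge_of_tendsto' hlim fun n => (h1 n i).trans ?_
  have h2 : v ≤ C • (1 : S → ℝ) := fun j => by simpa using hC j
  have := M.transOp_pow_mono π n h2 i
  rwa [map_smul] at this

theorem integral_abs_stageCost_le (M : SSP S A) {G : ℝ}
    (hG : ∀ π x, |M.stageCost π x| ≤ G * extendZero (1 : S → ℝ) x) (π : S → A) (i : S) (n : ℕ) :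
    ∫ s, |M.stageCost π (s n)| ∂(M.chainLaw π i) ≤ G * (M.transOp π ^ n) 1 i := by
  rw [← M.integral_chainLaw_eval π i n 1, ← integral_const_mul]
  exact integral_mono (M.integrable_chainLaw_eval π i n fun x => |M.stageCost π x|)
    (M.integrable_chainLaw_eval π i n fun x => G * extendZero 1 x) fun s => hG π (s n)

theorem measurable_observedCost (M : SSP S A) (π : S → A) : Measurable (M.observedCost π) :=
  Measurable.tsum fun n => (measurable_of_countable (M.stageCost π)).comp (measurable_pi_apply n)

theorem sum_range_two_mul_add_one (k : ℕ) :
    ∑ n ∈ Finset.range k, (2 * (n : ℝ) + 1) = (k : ℝ) ^ 2 := by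
  induction k with
  | zero => simp
  | succ k ih => rw [Finset.sum_range_succ, ih]; push_cast; ring

/-- With termination time `k` the cost is at most `G k` in absolute value, and `k ^ 2` is the sum of
the odd numbers `2 n + 1` over the times `n < k` at which the chain is alive. Taking expectations
then only involves survival probabilities. -/
theorem ae_sq_observedCost_le (M : SSP S A) {G : ℝ}
    (hG : ∀ π x, |M.stageCost π x| ≤ G * extendZero (1 : S → ℝ) x)
    {π : S → A} (hπ : M.IsProper π) (i : S) :
    ∀ᵐ s ∂(M.chainLaw π i), ENNReal.ofReal (M.observedCost π s ^ 2) ≤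
      ∑' n : ℕ, ENNReal.ofReal (G ^ 2 * (2 * n + 1)) *
        ENNReal.ofReal (extendZero (1 : S → ℝ) (s n)) := by
  classical
  filter_upwards [hπ i, M.ae_chainLaw_trap π i] with s hs ht
  set k := Nat.find hs with hk
  have hafter : ∀ n, k ≤ n → s n = none := by
    intro n hn
    induction n, hn using Nat.le_induction with
    | base => exact Nat.find_spec hs
    | succ n _ ih => exact ht n ih
  have hbefore : ∀ n, n < k → extendZero (1 : S → ℝ) (s n) = 1 := by
    intro n hn
    obtain ⟨j, hj⟩ := Option.ne_none_iff_exists'.1 (Nat.find_min hs hn)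
    rw [hj]; rfl
  have hobs : M.observedCost π s = ∑ n ∈ Finset.range k, M.stageCost π (s n) :=
    tsum_eq_sum fun n hn => by
      rw [hafter n (by simpa using hn)]; rfl
  have habs : |M.observedCost π s| ≤ G * k := by
    rw [hobs]
    refine (Finset.abs_sum_le_sum_abs _ _).trans ?_
    refine (Finset.sum_le_sum (g := fun _ => G) fun n hn => ?_).trans (by simp [mul_comm])
    simpa [hbefore n (Finset.mem_range.1 hn)] using hG π (s n)
  have hsq : M.observedCost π s ^ 2 ≤ ∑ n ∈ Finset.range k, G ^ 2 * (2 * (n : ℝ) + 1) := by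
    rw [← Finset.mul_sum, sum_range_two_mul_add_one, ← mul_pow, ← sq_abs]
    exact pow_le_pow_left₀ (abs_nonneg _) habs 2
  refine (ENNReal.ofReal_le_ofReal hsq).trans ?_
  rw [ENNReal.ofReal_sum_of_nonneg fun n _ => by positivity]
  refine le_trans (Finset.sum_le_sum fun n hn => ?_) (ENNReal.sum_le_tsum (Finset.range k))
  simp [hbefore n (Finset.mem_range.1 hn)]

/-- Maximal probability, over all nonstationary policies, of not having terminated in `n` steps. -/
noncomputable def maxSurvival (M : SSP S A) : ℕ → S → ℝ
  | 0 => 1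
  | n + 1 => fun i => ⨆ a : A, ∑ j, M.P i a j * M.maxSurvival n j

variable [Fintype A]

theorem sum_le_maxSurvival (M : SSP S A) (n : ℕ) (i : S) (a : A) :
    ∑ j, M.P i a j * M.maxSurvival n j ≤ M.maxSurvival (n + 1) i :=
  le_ciSup (f := fun a : A => ∑ j, M.P i a j * M.maxSurvival n j) (Set.finite_range _).bddAbove a

theorem exists_stageCost_bound (M : SSP S A) :
    ∃ G : ℝ, 0 ≤ G ∧ ∀ π x, |M.stageCost π x| ≤ G * extendZero (1 : S → ℝ) x := by
  refine ⟨∑ i, ∑ a, |M.g i a|, Finset.sum_nonneg fun _ _ => Finset.sum_nonneg fun _ _ =>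
    abs_nonneg _, fun π x => ?_⟩
  cases x with
  | none => simp [stageCost, extendZero]
  | some i =>
    have h1 := Finset.single_le_sum (f := fun a => |M.g i a|) (fun _ _ => abs_nonneg _)
      (Finset.mem_univ (π i))
    have h2 := Finset.single_le_sum (f := fun i => ∑ a, |M.g i a|)
      (fun _ _ => Finset.sum_nonneg fun _ _ => abs_nonneg _) (Finset.mem_univ i)
    simpa [stageCost, extendZero] using h1.trans h2

variable [Nonempty A]

theorem maxSurvival_nonneg (M : SSP S A) (n : ℕ) (i : S) : 0 ≤ M.maxSurvival n i := by
  induction n generalizing i with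
  | zero => exact zero_le_one
  | succ n ih =>
    exact (Finset.sum_nonneg fun j _ => mul_nonneg (M.P_nonneg i _ j) (ih j)).trans
      (M.sum_le_maxSurvival n i (Classical.arbitrary A))

theorem maxSurvival_antitone (M : SSP S A) (i : S) : Antitone fun n => M.maxSurvival n i := by
  have h : ∀ n i, M.maxSurvival (n + 1) i ≤ M.maxSurvival n i := by
    intro n
    induction n with
    | zero =>
      intro i
      refine ciSup_le fun a => ?_
      simpa [maxSurvival] using M.P_sum_le_one i a
    | succ n ih =>
      intro i
      refine ciSup_le fun a => le_trans ?_ (M.sum_le_maxSurvival n i a)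
      exact Finset.sum_le_sum fun j _ => mul_le_mul_of_nonneg_left (ih j) (M.P_nonneg i a j)
  exact antitone_nat_of_succ_le fun n => h n i

/-- In each state the decreasing limit `V` satisfies `V ≤ P_a V` for some action. These actions form
one stationary policy, and its properness forces `V ≤ 0`. So properness of stationary policies
controls nonstationary ones. -/
theorem tendsto_maxSurvival (M : SSP S A) (hM : ∀ π, M.IsProper π) (i : S) :
    Tendsto (fun n => M.maxSurvival n i) atTop (𝓝 0) := by
  set V : S → ℝ := fun i => ⨅ n, M.maxSurvival n i with hV
  have hbdd : ∀ i, BddBelow (Set.range fun n => M.maxSurvival n i) := fun i =>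
    ⟨0, by rintro _ ⟨n, rfl⟩; exact M.maxSurvival_nonneg n i⟩
  have hlim : ∀ i, Tendsto (fun n => M.maxSurvival n i) atTop (𝓝 (V i)) := fun i =>
    tendsto_atTop_ciInf (M.maxSurvival_antitone i) (hbdd i)
  have hex : ∀ i, ∃ a, V i ≤ ∑ j, M.P i a j * V j := by
    intro i
    -- Finiteness of `A` makes one `n` work for all actions at once, contradicting that `maxSurvival
    -- (n + 1)` is attained and dominates `V`.
    by_contra! hlt
    have hev : ∀ᶠ n in atTop, ∀ a, ∑ j, M.P i a j * M.maxSurvival n j < V i :=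
      eventually_all.2 fun a => (tendsto_finsetSum _ fun j _ =>
        (hlim j).const_mul (M.P i a j)).eventually_lt_const (hlt a)
    obtain ⟨n, hn⟩ := hev.exists
    obtain ⟨a, ha⟩ := exists_eq_ciSup_of_finite
      (f := fun a : A => ∑ j, M.P i a j * M.maxSurvival n j)
    have h1 : V i ≤ M.maxSurvival (n + 1) i := ciInf_le (hbdd i) (n + 1)
    have h2 : M.maxSurvival (n + 1) i = ∑ j, M.P i a j * M.maxSurvival n j := ha.symm
    exact absurd (hn a) (not_lt.2 (h2 ▸ h1))
  choose π hπ using hex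
  have hle : V i ≤ 0 := M.eq_zero_of_le_transOp (hM π) (C := 1)
    (fun j => ciInf_le (hbdd j) 0) hπ i
  have hge : 0 ≤ V i := le_ciInf fun n => M.maxSurvival_nonneg n i
  simpa [le_antisymm hle hge] using hlim i

/-- If every policy is proper then there is a bounded weight that decreases by a definite amount in
expectation under every action. -/
theorem exists_weight (M : SSP S A) (hM : ∀ π, M.IsProper π) :
    ∃ (ξ : S → ℝ) (K : ℝ), 1 ≤ K ∧ (∀ i, 1 ≤ ξ i) ∧ (∀ i, ξ i ≤ K) ∧
      ∀ i a, ∑ j, M.P i a j * ξ j ≤ ξ i - 1 / 2 := by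
  obtain ⟨N, hN⟩ := (eventually_all.2 fun i => (M.tendsto_maxSurvival hM i).eventually_le_const
    (show (0 : ℝ) < 1 / 2 by norm_num)).exists
  have hξ : ∀ i, 1 ≤ ∑ n ∈ Finset.range (N + 1), M.maxSurvival n i := fun i =>
    Finset.single_le_sum (f := fun n => M.maxSurvival n i)
      (fun n _ => M.maxSurvival_nonneg n i) (Finset.mem_range.2 N.succ_pos)
  -- Applying `P_a` shifts each index up by one, so the sum loses the term `1` at `n = 0` and gains
  -- at most the term at `N + 1`, which is at most `1/2`.
  refine ⟨fun i => ∑ n ∈ Finset.range (N + 1), M.maxSurvival n i, N + 1,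
    by linarith [N.cast_nonneg (α := ℝ)], hξ, fun i => ?_, fun i a => ?_⟩
  · have : ∀ n ∈ Finset.range (N + 1), M.maxSurvival n i ≤ 1 := fun n _ =>
      M.maxSurvival_antitone i (Nat.zero_le n)
    simpa using Finset.sum_le_sum this
  · simp_rw [Finset.mul_sum]
    rw [Finset.sum_comm]
    have h1 : ∑ n ∈ Finset.range (N + 1), ∑ j, M.P i a j * M.maxSurvival n j ≤
        ∑ n ∈ Finset.range (N + 1), M.maxSurvival (n + 1) i :=
      Finset.sum_le_sum fun n _ => M.sum_le_maxSurvival n i a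
    have h2 := Finset.sum_range_succ' (fun n => M.maxSurvival n i) (N + 1)
    have h3 := Finset.sum_range_succ (fun n => M.maxSurvival n i) (N + 1)
    have h4 : M.maxSurvival 0 i = 1 := rfl
    have h5 := M.maxSurvival_antitone i N.le_succ
    simp only at h5 h2 h3
    linarith [hN i]

/-- Under any policy the survival probabilities decay geometrically. -/
theorem exists_geometric_bound (M : SSP S A) (hM : ∀ π, M.IsProper π) :
    ∃ (C r : ℝ), 0 ≤ r ∧ r < 1 ∧ ∀ π n i, (M.transOp π ^ n) 1 i ≤ C * r ^ n := by
  obtain ⟨ξ, K, hK, h1, hξK, hdec⟩ := M.exists_weight hM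
  have hK0 : 0 < K := by linarith
  have hr : (1 : ℝ) / (2 * K) ≤ 1 / 2 := by
    rw [div_le_div_iff₀ (by positivity) (by norm_num)]; linarith
  have hr0 : (0 : ℝ) < 1 / (2 * K) := by positivity
  refine ⟨K, 1 - 1 / (2 * K), by linarith, by linarith, fun π n i => ?_⟩
  -- As `ξ ≤ K`, a drop of `1/2` is a relative drop of at least `1 / (2 * K)`.
  set r := 1 - 1 / (2 * K) with hrdef
  have hstep : M.transOp π ξ ≤ r • ξ := fun j => by
    have h := hdec j (π j)
    have : 1 / (2 * K) * ξ j ≤ 1 / 2 := by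
      calc 1 / (2 * K) * ξ j ≤ 1 / (2 * K) * K := mul_le_mul_of_nonneg_left (hξK j) hr0.le
        _ = 1 / 2 := by field_simp
    rw [transOp_apply, Pi.smul_apply, smul_eq_mul, hrdef]
    linarith
  have hpow : ∀ n, (M.transOp π ^ n) ξ ≤ r ^ n • ξ := by
    intro n
    induction n with
    | zero => simp
    | succ n ih =>
      rw [transOp_pow_succ']
      refine (M.transOp_pow_mono π n hstep).trans ?_
      rw [map_smul, pow_succ', mul_smul]
      exact smul_le_smul_of_nonneg_left ih (by linarith)
  calc (M.transOp π ^ n) 1 i ≤ (M.transOp π ^ n) ξ i := M.transOp_pow_mono π n h1 i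
    _ ≤ r ^ n * ξ i := hpow n i
    _ ≤ r ^ n * K := mul_le_mul_of_nonneg_left (hξK i) (pow_nonneg (by linarith) n)
    _ = K * r ^ n := mul_comm _ _

/-- Expectation and sum over time may be exchanged because the expected absolute stage costs decay
geometrically. -/
theorem hasSum_costToGo (M : SSP S A) (hM : ∀ π, M.IsProper π) (π : S → A) (i : S) :
    HasSum (fun n => (M.transOp π ^ n) (fun j => M.g j (π j)) i) (M.costToGo π i) := by
  obtain ⟨C, r, hr0, hr1, hCr⟩ := M.exists_geometric_bound hM
  obtain ⟨G, hG0, hG⟩ := M.exists_stageCost_bound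
  have h := hasSum_integral_of_summable_integral_norm (μ := M.chainLaw π i)
    (F := fun n s => M.stageCost π (s n)) (fun n => M.integrable_chainLaw_eval π i n _) (by
      refine Summable.of_nonneg_of_le (fun n => integral_nonneg fun _ => norm_nonneg _)
        (fun n => (M.integral_abs_stageCost_le hG π i n).trans
          (mul_le_mul_of_nonneg_left (hCr π n i) hG0))
        (((summable_geometric_of_lt_one hr0 hr1).mul_left C).mul_left G))
  simp_rw [stageCost_eq, integral_chainLaw_eval] at h
  simp only [costToGo, observedCost, stageCost_eq]
  exact h

theorem bellmanPolicy_costToGo (M : SSP S A) (hM : ∀ π, M.IsProper π) (π : S → A) :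
    M.bellmanPolicy π (M.costToGo π) = M.costToGo π := by
  funext i
  have h1 : HasSum (fun n => (M.transOp π ^ (n + 1)) (fun j => M.g j (π j)) i)
      (M.transOp π (M.costToGo π) i) := by
    simp_rw [transOp_pow_succ, transOp_apply]
    exact hasSum_sum fun j _ => (M.hasSum_costToGo hM π j).mul_left _
  have h2 := (hasSum_nat_add_iff' 1).2 (M.hasSum_costToGo hM π i)
  have h3 := h1.unique h2
  rw [bellmanPolicy_eq, Pi.add_apply, h3]
  simp

/-- The difference `J^π - z` is dominated by its own image under `P_π`, so the maximum principle
applies. -/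
theorem costToGo_le_of_bellmanPolicy_le (M : SSP S A) (hM : ∀ π, M.IsProper π) {π : S → A}
    {z : S → ℝ} (hz : M.bellmanPolicy π z ≤ z) : M.costToGo π ≤ z := by
  intro i
  have hv : M.costToGo π - z ≤ M.transOp π (M.costToGo π - z) := fun j => by
    have h1 := congrFun (M.bellmanPolicy_costToGo hM π) j
    have h2 := hz j
    rw [bellmanPolicy_eq, Pi.add_apply] at h1 h2
    rw [map_sub, Pi.sub_apply, Pi.sub_apply]
    linarith
  have := M.eq_zero_of_le_transOp (hM π) (C := ∑ j, |(M.costToGo π - z) j|)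
    (fun j => (le_abs_self _).trans (Finset.single_le_sum
      (f := fun j => |(M.costToGo π - z) j|) (fun _ _ => abs_nonneg _) (Finset.mem_univ j))) hv i
  simpa using this

theorem memLp_observedCost (M : SSP S A) (hM : ∀ π, M.IsProper π) (π : S → A) (i : S) :
    MemLp (M.observedCost π) 2 (M.chainLaw π i) := by
  obtain ⟨C, r, hr0, hr1, hCr⟩ := M.exists_geometric_bound hM
  obtain ⟨G, hG0, hG⟩ := M.exists_stageCost_bound
  have hmeas := M.measurable_observedCost π
  rw [memLp_two_iff_integrable_sq hmeas.aestronglyMeasurable]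
  refine ⟨(hmeas.pow_const 2).aestronglyMeasurable, ?_⟩
  rw [hasFiniteIntegral_iff_ofReal (ae_of_all _ fun s => sq_nonneg _)]
  refine (lintegral_mono_ae (M.ae_sq_observedCost_le hG (hM π) i)).trans_lt ?_
  have hm : ∀ n : ℕ, Measurable fun s : ℕ → Option S =>
      ENNReal.ofReal (extendZero (1 : S → ℝ) (s n)) := fun n =>
    ((measurable_of_countable _).comp (measurable_pi_apply n) : Measurable
      ((fun x => ENNReal.ofReal (extendZero (1 : S → ℝ) x)) ∘ fun s : ℕ → Option S => s n))
  rw [lintegral_tsum fun n => ((hm n).const_mul _).aemeasurable]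
  simp_rw [lintegral_const_mul _ (hm _), M.lintegral_chainLaw_eval π i _ zero_le_one]
  have hsum : Summable fun n : ℕ => G ^ 2 * (2 * n + 1) * (C * r ^ n) := by
    have h1 := summable_pow_mul_geometric_of_norm_lt_one 1 (r := r)
      (by rwa [Real.norm_eq_abs, abs_of_nonneg hr0])
    have h2 := summable_geometric_of_lt_one hr0 hr1
    exact (((h1.mul_left 2).add h2).mul_left (G ^ 2 * C)).congr fun n => by ring
  refine lt_of_le_of_lt (ENNReal.tsum_le_tsum fun n => ?_) hsum.tsum_ofReal_lt_top
  rw [← ENNReal.ofReal_mul (by positivity)]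
  exact ENNReal.ofReal_le_ofReal (mul_le_mul_of_nonneg_left (hCr π n i) (by positivity))

end SSP

/-! ### Deterministic convergence of perturbed optimistic policy iteration. -/

namespace SSP
variable {S A : Type*} [Fintype S]

theorem transOp_const_le (M : SSP S A) (π : S → A) {c : ℝ} (hc : 0 ≤ c) (i : S) :
    M.transOp π (fun _ => c) i ≤ c := by
  rw [transOp_apply, ← Finset.sum_mul]
  exact mul_le_of_le_one_left hc (M.P_sum_le_one i (π i))

theorem transOp_le_sum_abs (M : SSP S A) (π : S → A) (v : S → ℝ) (i : S) :
    M.transOp π v i ≤ ∑ j, |v j| := by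
  rw [transOp_apply]
  refine Finset.sum_le_sum fun j _ => ?_
  have h1 : M.P i (π i) j ≤ 1 :=
    (Finset.single_le_sum (fun j _ => M.P_nonneg i (π i) j) (Finset.mem_univ j)).trans
      (M.P_sum_le_one i (π i))
  exact (mul_le_mul_of_nonneg_left (le_abs_self _) (M.P_nonneg i _ j)).trans
    (mul_le_of_le_one_left (abs_nonneg _) h1)

variable [Fintype A]

theorem bellman_le_bellmanPolicy (M : SSP S A) (π : S → A) (v : S → ℝ) :
    M.bellman v ≤ M.bellmanPolicy π v := fun i =>
  ciInf_le (f := fun a : A => M.g i a + ∑ j, M.P i a j * v j) (Set.finite_range _).bddBelow (π i)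

/-- If the Bellman operator increases `v` by at most `c`, then the cost of a greedy policy exceeds
one Bellman step by at most a multiple of `c`. -/
theorem costToGo_greedy_le (M : SSP S A) (hM : ∀ π, M.IsProper π) [Nonempty A] {ξ : S → ℝ}
    (hdec : ∀ i a, ∑ j, M.P i a j * ξ j ≤ ξ i - 1 / 2) {π : S → A} {v : S → ℝ}
    (hg : M.bellmanPolicy π v = M.bellman v) {c : ℝ} (hc : 0 ≤ c)
    (hv : ∀ i, M.bellman v i - v i ≤ c) (i : S) :
    M.costToGo π i ≤ M.bellman v i + 2 * c * ξ i := by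
  -- The factor `2 * c` is chosen so that the drop of `1/2` in `ξ` pays for the `c` by which `T v`
  -- may exceed `v`, making this a supersolution for `π`.
  have hz : M.bellmanPolicy π (M.bellman v + (2 * c) • ξ) ≤ M.bellman v + (2 * c) • ξ := by
    intro j
    have h1 : M.bellman v j = M.g j (π j) + M.transOp π v j := by
      rw [← hg, bellmanPolicy_eq]; rfl
    have h2 : M.transOp π (M.bellman v) j ≤ M.transOp π (v + fun _ => c) j :=
      M.transOp_mono π (fun k => by simpa [add_comm] using hv k) j
    have h3 := M.transOp_const_le π hc j
    have h4 : M.transOp π ξ j ≤ ξ j - 1 / 2 := hdec j (π j)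
    rw [bellmanPolicy_eq, Pi.add_apply, Pi.add_apply, map_add, map_smul, Pi.add_apply,
      Pi.smul_apply, Pi.smul_apply, smul_eq_mul, smul_eq_mul]
    rw [map_add, Pi.add_apply] at h2
    nlinarith [mul_le_mul_of_nonneg_left h4 hc]
  exact M.costToGo_le_of_bellmanPolicy_le hM hz i

variable {γ : ℕ → ℝ} {J : ℕ → S → ℝ} {pol : ℕ → S → A} {e r : ℕ → S → ℝ}

open Classical in
-- There are finitely many policies, so the series splits into one per policy. This allows noise to
-- be multiplied by the time-varying matrix of `pol t`, constant within each piece.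
theorem exists_tendsto_sum_policy (F : (S → A) → ℕ → ℝ)
    (he : ∀ π, ∃ l, Tendsto (fun N => ∑ t ∈ Finset.range N, if pol t = π then F π t else 0)
      atTop (𝓝 l)) :
    ∃ l, Tendsto (fun N => ∑ t ∈ Finset.range N, F (pol t) t) atTop (𝓝 l) := by
  choose l hl using he
  refine ⟨∑ π, l π, (tendsto_finsetSum Finset.univ fun π _ => hl π).congr fun N => ?_⟩
  rw [Finset.sum_comm]
  simp

open Classical in
theorem exists_tendsto_sum_transOp_sub (M : SSP S A)
    (he : ∀ π i, ∃ l, Tendsto (fun N => ∑ t ∈ Finset.range N, if pol t = π then e t i else 0)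
      atTop (𝓝 l)) (i : S) :
    ∃ l, Tendsto (fun N => ∑ t ∈ Finset.range N, (M.transOp (pol t) (e t) i - e t i))
      atTop (𝓝 l) := by
  refine exists_tendsto_sum_policy (fun π t => M.transOp π (e t) i - e t i) fun π => ?_
  choose l hl using he π
  refine ⟨(∑ j, M.P i (π i) j * l j) - l i, ((tendsto_finsetSum Finset.univ fun j _ =>
    (hl j).const_mul (M.P i (π i) j)).sub (hl i)).congr fun N => ?_⟩
  simp_rw [Finset.mul_sum]
  rw [Finset.sum_comm, ← Finset.sum_sub_distrib]
  refine Finset.sum_congr rfl fun t _ => ?_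
  by_cases h : pol t = π <;> simp [h, transOp_apply]

open Classical in
/-- The Bellman residuals of the iterates are asymptotically nonpositive. -/
theorem eventually_bellman_sub_le (M : SSP S A) [Nonempty A] (hM : ∀ π, M.IsProper π)
    (h0 : ∀ t, 0 ≤ γ t) (hγ0 : Tendsto γ atTop (𝓝 0))
    (hγ : Tendsto (fun N => ∑ t ∈ Finset.range N, γ t) atTop atTop)
    (hg : ∀ t, M.bellmanPolicy (pol t) (J t) = M.bellman (J t))
    (hr : ∀ i, Tendsto (fun t => r t i) atTop (𝓝 0))
    (he : ∀ π i, ∃ l, Tendsto (fun N => ∑ t ∈ Finset.range N, if pol t = π then e t i else 0)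
      atTop (𝓝 l))
    (hJ : ∀ t, J (t + 1) = (1 - γ t) • J t + γ t • (M.costToGo (pol t) + r t) + e t)
    (i : S) : ∀ ε > 0, ∀ᶠ t in atTop, M.bellman (J t) i - J t i ≤ ε := by
  obtain ⟨l, hl⟩ := M.exists_tendsto_sum_transOp_sub he i
  have hb : Tendsto (fun t => (∑ j, |r t j|) - r t i) atTop (𝓝 0) := by
    simpa using (tendsto_finsetSum Finset.univ fun j _ => (hr j).abs).sub (hr i)
  have key := eventually_le_of_stochastic_approx (B := 0)
    (x := fun t => M.bellman (J t) i - J t i) h0 hγ0 hγ (fun t => ?_) hl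
    (fun ε hε => hb.eventually_le_const (by linarith))
  · simpa using key
  · have h1 := M.bellman_le_bellmanPolicy (pol t) (J (t + 1)) i
    have h2 : M.bellman (J t) i = M.g i (pol t i) + M.transOp (pol t) (J t) i := by
      rw [← hg, bellmanPolicy_eq]; rfl
    have h3 := congrFun (M.bellmanPolicy_costToGo hM (pol t)) i
    have h4 := mul_le_mul_of_nonneg_left (M.transOp_le_sum_abs (pol t) (r t) i) (h0 t)
    rw [bellmanPolicy_eq, Pi.add_apply] at h1 h3
    rw [hJ] at h1 ⊢
    simp only [map_add, map_smul, Pi.add_apply, Pi.smul_apply, smul_eq_mul] at h1 ⊢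
    have h5 := congrArg (fun x => γ t * x) h3
    have h6 := congrArg (fun x => γ t * x) h2
    linarith

theorem optCost_le_costToGo (M : SSP S A) (π : S → A) (i : S) : M.optCost i ≤ M.costToGo π i := by
  classical
  exact ciInf_le (f := fun π : S → A => M.costToGo π i) (Set.finite_range _).bddBelow π

open Classical in
/-- The iterates are asymptotically at most the cost of any fixed policy. -/
theorem eventually_le_costToGo (M : SSP S A) [Nonempty A] (hM : ∀ π, M.IsProper π)
    (h0 : ∀ t, 0 ≤ γ t) (hγ0 : Tendsto γ atTop (𝓝 0))
    (hγ : Tendsto (fun N => ∑ t ∈ Finset.range N, γ t) atTop atTop)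
    (hg : ∀ t, M.bellmanPolicy (pol t) (J t) = M.bellman (J t))
    (hr : ∀ i, Tendsto (fun t => r t i) atTop (𝓝 0))
    (he : ∀ π i, ∃ l, Tendsto (fun N => ∑ t ∈ Finset.range N, if pol t = π then e t i else 0)
      atTop (𝓝 l))
    (hJ : ∀ t, J (t + 1) = (1 - γ t) • J t + γ t • (M.costToGo (pol t) + r t) + e t)
    (π : S → A) (i : S) : ∀ ε > 0, ∀ᶠ t in atTop, J t i ≤ M.costToGo π i + ε := by
  obtain ⟨ξ, K, hK, hξ1, hξK, hdec⟩ := M.exists_weight hM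
  have hres := M.eventually_bellman_sub_le hM h0 hγ0 hγ hg hr he hJ
  have hconv : ∀ i, ∃ l, Tendsto (fun N => ∑ t ∈ Finset.range N, e t i) atTop (𝓝 l) := fun i =>
    exists_tendsto_sum_policy (fun _ t => e t i) fun π => he π i
  set x : ℕ → S → ℝ := fun t => J t - M.costToGo π with hx
  set b : ℕ → S → ℝ := fun t => M.costToGo (pol t) - M.costToGo π + r t with hb
  have hrec : ∀ i t, x (t + 1) i = (1 - γ t) * x t i + γ t * b t i + e t i := fun i t => by
    simp only [hx, hb, hJ, Pi.add_apply, Pi.sub_apply, Pi.smul_apply, smul_eq_mul]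
    ring
  -- An asymptotic upper bound on the targets `b` passes to `x`; conversely, a bound on `x` yields a
  -- bound on `b` improved by one application of `P_π`. Alternating the two gives `hiter`.
  have happrox : ∀ (u : S → ℝ), (∀ i, ∀ ε > 0, ∀ᶠ t in atTop, b t i ≤ u i + ε) →
      ∀ i, ∀ ε > 0, ∀ᶠ t in atTop, x t i ≤ u i + ε := fun u hu i => by
    obtain ⟨l, hl⟩ := hconv i
    exact eventually_le_of_stochastic_approx h0 hγ0 hγ (fun t => (hrec i t).le) hl (hu i)
  set C : ℝ := ∑ μ : S → A, ∑ j, |M.costToGo μ j - M.costToGo π j| with hC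
  have hiter : ∀ n i, ∀ ε > 0, ∀ᶠ t in atTop, x t i ≤ (M.transOp π ^ n) (fun _ => C) i + ε := by
    intro n
    induction n with
    | zero =>
      refine happrox _ fun i ε hε => ?_
      filter_upwards [(hr i).eventually_le_const hε] with t ht
      have h1 := Finset.single_le_sum (f := fun j => |M.costToGo (pol t) j - M.costToGo π j|)
        (fun _ _ => abs_nonneg _) (Finset.mem_univ i)
      have h2 := Finset.single_le_sum
        (f := fun μ : S → A => ∑ j, |M.costToGo μ j - M.costToGo π j|)
        (fun _ _ => Finset.sum_nonneg fun _ _ => abs_nonneg _) (Finset.mem_univ (pol t))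
      have h3 := le_abs_self (M.costToGo (pol t) i - M.costToGo π i)
      simp only [hb, Pi.add_apply, Pi.sub_apply, pow_zero, Module.End.one_apply]
      linarith
    | succ n ih =>
      refine happrox _ fun i ε hε => ?_
      have hK0 : 0 < K := by linarith
      -- Error budget: `ε / 4` from the induction hypothesis, `2 * (ε / (4 * K)) * ξ ≤ ε / 2` from
      -- the residual, and `ε / 4` from `r`.
      filter_upwards [eventually_all.2 fun j => ih j (ε / 4) (by positivity),
        eventually_all.2 fun j => hres j (ε / (4 * K)) (by positivity),
        (hr i).eventually_le_const (show (0 : ℝ) < ε / 4 by positivity)] with t h1 h2 h3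
      have h4 := M.costToGo_greedy_le hM hdec (hg t)
        (show 0 ≤ ε / (4 * K) by positivity) h2 i
      have h5 : 2 * (ε / (4 * K)) * ξ i ≤ ε / 2 := by
        calc 2 * (ε / (4 * K)) * ξ i ≤ 2 * (ε / (4 * K)) * K :=
              mul_le_mul_of_nonneg_left (hξK i) (by positivity)
          _ = ε / 2 := by field_simp; ring
      have h6 := M.bellman_le_bellmanPolicy π (J t) i
      have h7 := congrFun (M.bellmanPolicy_costToGo hM π) i
      rw [bellmanPolicy_eq, Pi.add_apply] at h6 h7
      have h8 : M.transOp π (x t) i ≤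
          M.transOp π ((M.transOp π ^ n) (fun _ => C) + fun _ => ε / 4) i :=
        M.transOp_mono π h1 i
      have h9 := M.transOp_const_le π (show 0 ≤ ε / 4 by positivity) i
      rw [transOp_pow_succ]
      simp only [hx, hb, map_add, map_sub, Pi.add_apply, Pi.sub_apply] at h8 ⊢
      linarith
  intro ε hε
  have hlim := (M.tendsto_transOp_pow_one (hM π) i).const_mul C
  rw [mul_zero] at hlim
  obtain ⟨n, hn⟩ := (hlim.eventually_le_const (half_pos hε)).exists
  filter_upwards [hiter n i (ε / 2) (half_pos hε)] with t ht
  have h1 : (fun _ => C : S → ℝ) = C • 1 := by ext; simp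
  rw [h1, map_smul, Pi.smul_apply, smul_eq_mul] at ht
  simp only [hx, Pi.sub_apply] at ht
  linarith

open Classical in
/-- Deterministic convergence of optimistic policy iteration, along one path: the perturbations `e`
have convergent partial sums along each policy, and `r` vanishes asymptotically. -/
theorem tendsto_optCost_of_perturbed (M : SSP S A) [Nonempty A] (hM : ∀ π, M.IsProper π)
    (h0 : ∀ t, 0 ≤ γ t) (hγ0 : Tendsto γ atTop (𝓝 0))
    (hγ : Tendsto (fun N => ∑ t ∈ Finset.range N, γ t) atTop atTop)
    (hg : ∀ t, M.bellmanPolicy (pol t) (J t) = M.bellman (J t))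
    (hr : ∀ i, Tendsto (fun t => r t i) atTop (𝓝 0))
    (he : ∀ π i, ∃ l, Tendsto (fun N => ∑ t ∈ Finset.range N, if pol t = π then e t i else 0)
      atTop (𝓝 l))
    (hJ : ∀ t, J (t + 1) = (1 - γ t) • J t + γ t • (M.costToGo (pol t) + r t) + e t) :
    Tendsto J atTop (𝓝 M.optCost) := by
  rw [tendsto_pi_nhds]
  intro i
  rw [tendsto_order]
  refine ⟨fun c hc => ?_, fun c hc => ?_⟩
  · obtain ⟨l, hl⟩ := exists_tendsto_sum_policy (fun _ t => e t i) fun π => he π i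
    filter_upwards [eventually_ge_of_stochastic_approx (B := M.optCost i) (x := fun t => J t i)
      (b := fun t => M.costToGo (pol t) i + r t i) h0 hγ0 hγ (fun t => by
        rw [hJ]; simp only [Pi.add_apply, Pi.smul_apply, smul_eq_mul]; exact le_rfl) hl
      (fun ε hε => by
        filter_upwards [(hr i).eventually_const_le (neg_lt_zero.2 hε)] with t ht
        linarith [M.optCost_le_costToGo (pol t) i]) ((M.optCost i - c) / 2) (by linarith)]
      with t ht
    linarith
  · obtain ⟨π, hπ⟩ := exists_eq_ciInf_of_finite (f := fun π : S → A => M.costToGo π i)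
    have hπ' : M.costToGo π i = M.optCost i := hπ
    filter_upwards [M.eventually_le_costToGo hM h0 hγ0 hγ hg hr he hJ π i
      ((c - M.optCost i) / 2) (by linarith)] with t ht
    linarith

end SSP

/-! ### Martingale convergence. -/

/-- An `L²`-bounded series of martingale differences converges almost surely. -/
theorem ae_exists_tendsto_sum_of_condExp_eq_zero {Ω : Type*} {m : MeasurableSpace Ω}
    {Pr : Measure Ω} [IsProbabilityMeasure Pr] (ℱ : Filtration ℕ m) {X : ℕ → Ω → ℝ}
    (hX : ∀ n, StronglyMeasurable[ℱ (n + 1)] (X n)) (h2 : ∀ n, MemLp (X n) 2 Pr)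
    (hc : ∀ n, Pr[X n | ℱ n] =ᵐ[Pr] 0) {C : ℝ}
    (hC : ∀ N, ∑ n ∈ Finset.range N, ∫ ω, X n ω ^ 2 ∂Pr ≤ C) :
    ∀ᵐ ω ∂Pr, ∃ l, Tendsto (fun N => ∑ n ∈ Finset.range N, X n ω) atTop (𝓝 l) := by
  set Z : ℕ → Ω → ℝ := fun N ω => ∑ n ∈ Finset.range N, X n ω with hZ
  have hZs : ∀ N, Z (N + 1) = Z N + X N := fun N => by
    funext ω; simp [hZ, Finset.sum_range_succ]
  have hadp : ∀ N, StronglyMeasurable[ℱ N] (Z N) := fun N =>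
    Finset.stronglyMeasurable_fun_sum _ fun n hn =>
      (hX n).mono (ℱ.mono (Nat.succ_le_of_lt (Finset.mem_range.1 hn)))
  have hZ2 : ∀ N, MemLp (Z N) 2 Pr := fun N => memLp_finsetSum _ fun n _ => h2 n
  have hint : ∀ N, Integrable (Z N) Pr := fun N => (hZ2 N).integrable one_le_two
  have hXint : ∀ N, Integrable (X N) Pr := fun N => (h2 N).integrable one_le_two
  have hmart : Martingale Z ℱ Pr := martingale_of_condExp_sub_eq_zero_nat hadp hint fun N => by
    rw [hZs, add_sub_cancel_left]
    exact hc N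
  have hcross : ∀ N, ∫ ω, (Z N * X N) ω ∂Pr = 0 := fun N => by
    have h1 : Integrable (Z N * X N) Pr := (hZ2 N).integrable_mul (h2 N)
    rw [← integral_condExp (ℱ.le N)]
    rw [integral_congr_ae (condExp_mul_of_stronglyMeasurable_left (hadp N) h1 (hXint N))]
    rw [integral_congr_ae (g := fun _ => (0 : ℝ)) ((hc N).mono fun ω hω => by simp [hω])]
    simp
  have hsq : ∀ N, ∫ ω, Z N ω ^ 2 ∂Pr = ∑ n ∈ Finset.range N, ∫ ω, X n ω ^ 2 ∂Pr := by
    intro N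
    induction N with
    | zero => simp [hZ]
    | succ N ih =>
      rw [Finset.sum_range_succ, ← ih]
      have h1 : Integrable (Z N * X N) Pr := (hZ2 N).integrable_mul (h2 N)
      have : ∀ ω, Z (N + 1) ω ^ 2 = Z N ω ^ 2 + X N ω ^ 2 + 2 * (Z N * X N) ω := fun ω => by
        rw [hZs]; simp only [Pi.add_apply, Pi.mul_apply]; ring
      simp_rw [this]
      have h3 : Integrable (fun ω => Z N ω ^ 2 + X N ω ^ 2) Pr :=
        (hZ2 N).integrable_sq.add (h2 N).integrable_sq
      rw [integral_add h3 (h1.const_mul 2), integral_add (hZ2 N).integrable_sq (h2 N).integrable_sq, integral_const_mul, hcross]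
      ring
  refine hmart.submartingale.exists_ae_tendsto_of_bdd (R := (1 + C).toNNReal) fun N => ?_
  rw [eLpNorm_one_eq_lintegral_enorm, ← ofReal_integral_norm_eq_lintegral_enorm (hint N)]
  refine ENNReal.ofReal_le_ofReal ?_
  -- Orthogonality of increments bounds the second moment; `|z| ≤ 1 + z ^ 2` turns this into the
  -- `L¹` bound required for submartingale convergence.
  calc ∫ ω, ‖Z N ω‖ ∂Pr ≤ ∫ ω, (1 + Z N ω ^ 2) ∂Pr :=
        integral_mono (hint N).norm ((integrable_const 1).add (hZ2 N).integrable_sq) fun ω => by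
          simp only [Real.norm_eq_abs]
          nlinarith [sq_abs (Z N ω), sq_nonneg (|Z N ω| - 1), abs_nonneg (Z N ω)]
    _ = 1 + ∫ ω, Z N ω ^ 2 ∂Pr := by
        rw [integral_add (integrable_const 1) (hZ2 N).integrable_sq]; simp
    _ ≤ 1 + C := by rw [hsq]; linarith [hC N]

/-! ### Conditional law of a sample and convergence of weighted noise. -/

namespace SSP.IsMCES
variable {S A Ω : Type*} [Fintype S] [DecidableEq S] {m : MeasurableSpace Ω} {M : SSP S A}
  {p : S → ℝ} {Pr : Measure Ω} {ℱ : Filtration ℕ m}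
  {J : ℕ → Ω → S → ℝ} {pol : ℕ → Ω → S → A} {sel : ℕ → Ω → S} {traj : ℕ → Ω → ℕ → Option S}
  {step : ℕ → Ω → S → ℝ}

theorem measurableSet_event (h : M.IsMCES p Pr ℱ J pol sel traj step) (t : ℕ) (π : S → A) (i : S) :
    MeasurableSet[ℱ (t + 1)] {ω | pol t ω = π ∧ sel t ω = i} :=
  MeasurableSet.inter (ℱ.mono t.le_succ _ (h.pol_measurable t π)) (h.sel_measurable t i)

/-- The observed quantity `φ (traj t)` on the event that the policy is `π` and `i` is selected. -/
noncomputable def sampled (pol : ℕ → Ω → S → A) (sel : ℕ → Ω → S) (traj : ℕ → Ω → ℕ → Option S)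
    (π : S → A) (i : S) (φ : (ℕ → Option S) → ℝ) (t : ℕ) : Ω → ℝ :=
  {ω | pol t ω = π ∧ sel t ω = i}.indicator fun ω => φ (traj t ω)

theorem measurable_sampled (h : M.IsMCES p Pr ℱ J pol sel traj step) (π : S → A) (i : S)
    {φ : (ℕ → Option S) → ℝ} (hφ : Measurable φ) (t : ℕ) :
    Measurable[ℱ (t + 1)] (sampled pol sel traj π i φ t) :=
  Measurable.indicator (hφ.comp (h.traj_measurable t)) (h.measurableSet_event t π i)

/-- Fixing the value `π` of the random policy turns the conditional law into a multiple of one fixed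
chain law, so integrals over `ℱ t`-sets, hence conditional expectations, become integrals against
`chainLaw`. -/
theorem map_traj_restrict (h : M.IsMCES p Pr ℱ J pol sel traj step) (t : ℕ) {F : Set Ω}
    (hF : MeasurableSet[ℱ t] F) (π : S → A) (i : S) :
    (Pr.restrict (F ∩ {ω | pol t ω = π ∧ sel t ω = i})).map (traj t) =
      (Pr (F ∩ {ω | pol t ω = π}) * ENNReal.ofReal (p i)) • M.chainLaw π i := by
  have hm : Measurable (traj t) := (h.traj_measurable t).mono (ℱ.le _) le_rfl
  ext B hB
  rw [Measure.map_apply hm hB, Measure.restrict_apply (hm hB), Measure.smul_apply, smul_eq_mul,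
    ← h.sample t F hF π i B hB]
  congr 1
  ext ω
  simp only [Set.mem_inter_iff, Set.mem_preimage, Set.mem_ofPred_eq]
  tauto

variable [IsProbabilityMeasure Pr]

theorem integrable_sampled (h : M.IsMCES p Pr ℱ J pol sel traj step) (π : S → A) (i : S)
    {φ : (ℕ → Option S) → ℝ} (hφ : Integrable φ (M.chainLaw π i)) (t : ℕ) :
    Integrable (sampled pol sel traj π i φ t) Pr := by
  have hm : Measurable (traj t) := (h.traj_measurable t).mono (ℱ.le _) le_rfl
  rw [sampled, integrable_indicator_iff (ℱ.le _ _ (h.measurableSet_event t π i))]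
  have h1 := h.map_traj_restrict t (MeasurableSet.univ : MeasurableSet[ℱ t] Set.univ) π i
  rw [Set.univ_inter, Set.univ_inter] at h1
  refine Integrable.comp_measurable ?_ hm
  rw [h1]
  exact hφ.smul_measure (ENNReal.mul_ne_top (measure_ne_top _ _) ENNReal.ofReal_ne_top)

theorem condExp_sampled (h : M.IsMCES p Pr ℱ J pol sel traj step) (hp : ∀ i, 0 ≤ p i) (π : S → A)
    (i : S) {φ : (ℕ → Option S) → ℝ} (hφ : Integrable φ (M.chainLaw π i)) (t : ℕ) :
    Pr[sampled pol sel traj π i φ t | ℱ t] =ᵐ[Pr]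
      {ω | pol t ω = π}.indicator fun _ => p i * ∫ s, φ s ∂(M.chainLaw π i) := by
  have hm : Measurable (traj t) := (h.traj_measurable t).mono (ℱ.le _) le_rfl
  have hpm := h.pol_measurable t π
  symm
  refine ae_eq_condExp_of_forall_setIntegral_eq (ℱ.le t) (h.integrable_sampled π i hφ t)
    (fun F _ _ => ((integrable_const _).indicator (ℱ.le _ _ hpm)).integrableOn) (fun F hF _ => ?_)
    (StronglyMeasurable.aestronglyMeasurable (stronglyMeasurable_const.indicator hpm))
  rw [setIntegral_indicator (ℱ.le _ _ hpm), setIntegral_const, sampled,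
    setIntegral_indicator (ℱ.le _ _ (h.measurableSet_event t π i))]
  have h1 := h.map_traj_restrict t hF π i
  rw [← integral_map (f := φ) hm.aemeasurable (by
    rw [h1]; exact hφ.aestronglyMeasurable.smul_measure _), h1, integral_smul_measure,
    ENNReal.toReal_mul, ENNReal.toReal_ofReal (hp i), smul_eq_mul, smul_eq_mul, Measure.real]
  ring

/-- Simulation noise, weighted by predictable coefficients with summable second moments, adds up
almost surely. -/
theorem ae_exists_tendsto_sum_noise (h : M.IsMCES p Pr ℱ J pol sel traj step) (hp : ∀ i, 0 ≤ p i)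
    (π : S → A) (i : S) {φ : (ℕ → Option S) → ℝ} (hφm : Measurable φ)
    (hφ : MemLp φ 2 (M.chainLaw π i)) {c : ℕ → Ω → ℝ} (hc : ∀ t, Measurable[ℱ t] (c t))
    {B : ℕ → ℝ} (hB : ∀ t ω, |c t ω| ≤ B t) {C : ℝ}
    (hC : ∀ N, ∑ t ∈ Finset.range N, ∫ ω, c t ω ^ 2 ∂Pr ≤ C) :
    ∀ᵐ ω ∂Pr, ∃ l, Tendsto (fun N => ∑ t ∈ Finset.range N, c t ω *
      (sampled pol sel traj π i φ t ω - {ω | pol t ω = π}.indicator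
        (fun _ => p i * ∫ s, φ s ∂(M.chainLaw π i)) ω)) atTop (𝓝 l) := by
  set q : ℝ := p i * ∫ s, φ s ∂(M.chainLaw π i) with hq
  have hφ1 : Integrable φ (M.chainLaw π i) := hφ.integrable one_le_two
  set X0 : ℕ → Ω → ℝ := fun t =>
    sampled pol sel traj π i φ t - {ω | pol t ω = π}.indicator (fun _ => q) with hX0
  have hcm : ∀ t, StronglyMeasurable[ℱ t] (c t) := fun t => (hc t).stronglyMeasurable
  have hindm : ∀ t, StronglyMeasurable[ℱ t] ({ω | pol t ω = π}.indicator fun _ => q) := fun t =>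
    stronglyMeasurable_const.indicator (h.pol_measurable t π)
  have hsq : ∀ t, (fun ω => sampled pol sel traj π i φ t ω ^ 2) =
      sampled pol sel traj π i (fun s => φ s ^ 2) t := fun t => by
    funext ω
    simp only [sampled, Set.indicator]
    split_ifs <;> simp
  have hsamp2 : ∀ t, MemLp (sampled pol sel traj π i φ t) 2 Pr := fun t => by
    rw [memLp_two_iff_integrable_sq
      ((h.measurable_sampled π i hφm t).mono (ℱ.le _) le_rfl).aestronglyMeasurable, hsq]
    exact h.integrable_sampled π i hφ.integrable_sq t
  have hind2 : ∀ t, MemLp ({ω | pol t ω = π}.indicator fun _ => q) 2 Pr := fun t =>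
    (memLp_const q).indicator (ℱ.le _ _ (h.pol_measurable t π))
  have hX02 : ∀ t, MemLp (X0 t) 2 Pr := fun t => (hsamp2 t).sub (hind2 t)
  have hX2 : ∀ t, MemLp (c t * X0 t) 2 Pr := fun t => by
    -- The pointwise bound `B t` serves only for integrability; the uniform variance bound comes
    -- from `hC`.
    refine MemLp.of_le_mul (c := B t) (hX02 t)
      (((hcm t).mono (ℱ.le t)).aestronglyMeasurable.mul (hX02 t).1) (ae_of_all _ fun ω => ?_)
    rw [Pi.mul_apply, norm_mul]
    exact mul_le_mul_of_nonneg_right (hB t ω) (norm_nonneg _)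
  have hcond0 : ∀ t, Pr[X0 t | ℱ t] =ᵐ[Pr] 0 := fun t => by
    refine (condExp_sub ((hsamp2 t).integrable one_le_two) ((hind2 t).integrable one_le_two)
      _).trans ?_
    rw [condExp_of_stronglyMeasurable (ℱ.le t) (hindm t) ((hind2 t).integrable one_le_two)]
    filter_upwards [h.condExp_sampled hp π i hφ1 t] with ω hω
    rw [Pi.sub_apply, hω, hq]
    simp
  have hcsq : ∀ t, Integrable (fun ω => c t ω ^ 2) Pr := fun t =>
    Integrable.of_bound (C := B t ^ 2) (((hc t).pow_const 2).mono (ℱ.le t) le_rfl).aestronglyMeasurable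
      (ae_of_all _ fun ω => by
        rw [Real.norm_eq_abs, abs_pow]
        exact pow_le_pow_left₀ (abs_nonneg _) (hB t ω) 2)
  set V : ℝ := ∫ s, φ s ^ 2 ∂(M.chainLaw π i) with hV
  have hV0 : 0 ≤ V := integral_nonneg fun s => sq_nonneg _
  have hprod : ∀ t, Integrable ((fun ω => c t ω ^ 2) * sampled pol sel traj π i (fun s => φ s ^ 2) t)
      Pr := fun t =>
    (h.integrable_sampled π i hφ.integrable_sq t).bdd_mul
      (c := B t ^ 2) (((hc t).pow_const 2).mono (ℱ.le t) le_rfl).aestronglyMeasurable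
      (ae_of_all _ fun ω => by
        rw [Real.norm_eq_abs, abs_pow]
        exact pow_le_pow_left₀ (abs_nonneg _) (hB t ω) 2)
  -- Conditioning on `ℱ t` pulls out the predictable `c t ^ 2` and leaves at most `p i * V`.
  have hmom : ∀ t, ∫ ω, ((fun ω => c t ω ^ 2) * sampled pol sel traj π i (fun s => φ s ^ 2) t) ω ∂Pr
      ≤ p i * V * ∫ ω, c t ω ^ 2 ∂Pr := fun t => by
    rw [← integral_condExp (ℱ.le t), integral_congr_ae (condExp_mul_of_stronglyMeasurable_left
      ((hc t).pow_const 2).stronglyMeasurable (hprod t)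
      (h.integrable_sampled π i hφ.integrable_sq t)), ← integral_const_mul]
    refine integral_mono_ae (integrable_condExp.congr (condExp_mul_of_stronglyMeasurable_left
      ((hc t).pow_const 2).stronglyMeasurable (hprod t)
      (h.integrable_sampled π i hφ.integrable_sq t))) ((hcsq t).const_mul _) ?_
    filter_upwards [h.condExp_sampled hp π i hφ.integrable_sq t] with ω hω
    rw [Pi.mul_apply, hω, mul_comm]
    refine mul_le_mul_of_nonneg_right ?_ (sq_nonneg _)
    simp only [Set.indicator]
    split_ifs
    · exact le_rfl
    · exact mul_nonneg (hp i) hV0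
  have hbound : ∀ t, ∫ ω, (c t * X0 t) ω ^ 2 ∂Pr ≤ (2 * (p i * V) + 2 * q ^ 2) *
      ∫ ω, c t ω ^ 2 ∂Pr := fun t => by
    calc ∫ ω, (c t * X0 t) ω ^ 2 ∂Pr
        ≤ ∫ ω, (2 * ((fun ω => c t ω ^ 2) * sampled pol sel traj π i (fun s => φ s ^ 2) t) ω +
            2 * q ^ 2 * c t ω ^ 2) ∂Pr := by
          refine integral_mono (hX2 t).integrable_sq (((hprod t).const_mul 2).add
            ((hcsq t).const_mul _)) fun ω => ?_
          have h1 := congrFun (hsq t) ω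
          have h2 : ({ω | pol t ω = π}.indicator (fun _ => q) ω) ^ 2 ≤ q ^ 2 := by
            simp only [Set.indicator]
            split_ifs
            · exact le_rfl
            · simpa using sq_nonneg q
          simp only [hX0, Pi.mul_apply, Pi.sub_apply, ← h1]
          set a := sampled pol sel traj π i φ t ω
          set d := {ω | pol t ω = π}.indicator (fun _ => q) ω
          have h3 : (a - d) ^ 2 ≤ 2 * a ^ 2 + 2 * q ^ 2 := by nlinarith [sq_nonneg (a + d)]
          have h4 := mul_le_mul_of_nonneg_left h3 (sq_nonneg (c t ω))
          nlinarith
      _ = 2 * (∫ ω, ((fun ω => c t ω ^ 2) * sampled pol sel traj π i (fun s => φ s ^ 2) t) ω ∂Pr) +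
            2 * q ^ 2 * ∫ ω, c t ω ^ 2 ∂Pr := by
          rw [integral_add ((hprod t).const_mul 2) ((hcsq t).const_mul _), integral_const_mul,
            integral_const_mul]
      _ ≤ _ := by linarith [hmom t]
  refine ae_exists_tendsto_sum_of_condExp_eq_zero ℱ (X := fun t => c t * X0 t)
    (C := (2 * (p i * V) + 2 * q ^ 2) * C) (fun t => ?_) hX2 (fun t => ?_) fun N => ?_
  · exact ((hcm t).mono (ℱ.mono t.le_succ)).mul
      ((h.measurable_sampled π i hφm t).stronglyMeasurable.sub ((hindm t).mono (ℱ.mono t.le_succ)))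
  · refine (condExp_mul_of_stronglyMeasurable_left (hcm t) ((hX2 t).integrable one_le_two)
      ((hX02 t).integrable one_le_two)).trans ?_
    filter_upwards [hcond0 t] with ω hω
    simp [hω]
  · refine (Finset.sum_le_sum fun t _ => hbound t).trans ?_
    rw [← Finset.mul_sum]
    exact mul_le_mul_of_nonneg_left (hC N) (by have := hp i; positivity)

end SSP.IsMCES

/-! ### Boundedness of the iterates and reduction to the deterministic recursion. -/

theorem abs_max_neg_min_le {K : ℝ} (hK : 0 ≤ K) (x : ℝ) : |max (-K) (min x K)| ≤ K :=
  abs_le.2 ⟨le_max_left _ _, max_le (by linarith) (min_le_right _ _)⟩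

namespace SSP.IsMCES
variable {S A Ω : Type*} [Fintype S] [DecidableEq S] {m : MeasurableSpace Ω}
  {M : SSP S A} {p : S → ℝ} {Pr : Measure Ω} {ℱ : Filtration ℕ m}
  {J : ℕ → Ω → S → ℝ} {pol : ℕ → Ω → S → A} {sel : ℕ → Ω → S} {traj : ℕ → Ω → ℕ → Option S}
  {step c : ℕ → Ω → S → ℝ}

/-- Noise of the state selection, weighted by predictable coefficients. -/
theorem ae_exists_tendsto_sum_selection_noise [IsProbabilityMeasure Pr] (h : M.IsMCES p Pr ℱ J pol sel traj step)
    (hp : ∀ i, 0 ≤ p i) (π : S → A) (i : S) {c : ℕ → Ω → ℝ} (hc : ∀ t, Measurable[ℱ t] (c t))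
    {B : ℕ → ℝ} (hB : ∀ t ω, |c t ω| ≤ B t) {C : ℝ}
    (hC : ∀ N, ∑ t ∈ Finset.range N, ∫ ω, c t ω ^ 2 ∂Pr ≤ C) :
    ∀ᵐ ω ∂Pr, ∃ l, Tendsto (fun N => ∑ t ∈ Finset.range N, c t ω *
      (sampled pol sel traj π i 1 t ω - {ω | pol t ω = π}.indicator
        (fun _ => p i) ω)) atTop (𝓝 l) := by
  have := h.ae_exists_tendsto_sum_noise hp π i (φ := 1) measurable_const (memLp_const 1) hc hB hC
  simpa using this

variable [Fintype A]

theorem measurable_observedCost_pol (h : M.IsMCES p Pr ℱ J pol sel traj step) (t : ℕ) :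
    Measurable[ℱ (t + 1)] fun ω => M.observedCost (pol t ω) (traj t ω) := by
  classical
  have heq : (fun ω => M.observedCost (pol t ω) (traj t ω)) = fun ω =>
      ∑ π : S → A, {ω | pol t ω = π}.indicator (fun ω => M.observedCost π (traj t ω)) ω := by
    funext ω
    simp [Set.indicator]
  rw [heq]
  exact Finset.measurable_fun_sum _ fun π _ =>
    ((M.measurable_observedCost π).comp (h.traj_measurable t)).indicator
      (ℱ.mono t.le_succ _ (h.pol_measurable t π))

/-- The stepsize enters only at the selected state, where it equals the predictable `c`, so
adaptedness propagates even if `step` is not predictable. -/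
theorem measurable_value (h : M.IsMCES p Pr ℱ J pol sel traj step)
    (hstep : ∀ t ω, step t ω (sel t ω) = c t ω (sel t ω))
    (hc : ∀ t i, Measurable[ℱ t] fun ω => c t ω i) (t : ℕ) (i : S) :
    Measurable[ℱ t] fun ω => J t ω i := by
  induction t with
  | zero => exact (measurable_pi_apply i).comp h.init_measurable
  | succ t ih =>
    have heq : (fun ω => J (t + 1) ω i) = fun ω => if sel t ω = i then
        (1 - c t ω i) * J t ω i + c t ω i * M.observedCost (pol t ω) (traj t ω) else J t ω i := by
      funext ω
      rw [h.update]
      split_ifs with hs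
      · have := hstep t ω
        rw [hs] at this
        rw [this]
      · rfl
    rw [heq]
    have hc' := (hc t i).mono (ℱ.mono t.le_succ) le_rfl
    have hJ' := ih.mono (ℱ.mono t.le_succ) le_rfl
    exact Measurable.ite (h.sel_measurable t i)
      (((measurable_const.sub hc').mul hJ').add (hc'.mul (h.measurable_observedCost_pol t))) hJ'

variable [IsProbabilityMeasure Pr] [Nonempty A]

/-- Monte Carlo noise relative to the true cost of the current policy. -/
theorem ae_exists_tendsto_sum_cost_noise (h : M.IsMCES p Pr ℱ J pol sel traj step)
    (hM : ∀ π, M.IsProper π) (hp : ∀ i, 0 ≤ p i)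
    (hc : ∀ t i, Measurable[ℱ t] fun ω => c t ω i)
    {B : ℕ → ℝ} (hB : ∀ t ω i, |c t ω i| ≤ B t) {C : ℝ}
    (hC : ∀ i N, ∑ t ∈ Finset.range N, ∫ ω, c t ω i ^ 2 ∂Pr ≤ C) (π : S → A) (i : S) :
    ∀ᵐ ω ∂Pr, ∃ l, Tendsto (fun N => ∑ t ∈ Finset.range N, c t ω i *
      (sampled pol sel traj π i (M.observedCost π) t ω - {ω | pol t ω = π}.indicator
        (fun _ => p i * M.costToGo π i) ω)) atTop (𝓝 l) :=
  h.ae_exists_tendsto_sum_noise hp π i (M.measurable_observedCost π) (M.memLp_observedCost hM π i)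
    (fun t => hc t i) (fun t ω => hB t ω i) (hC i)

/-- The iterates are almost surely bounded. -/
theorem ae_exists_bound (h : M.IsMCES p Pr ℱ J pol sel traj step)
    (hM : ∀ π, M.IsProper π) (hp : ∀ i, 0 < p i)
    (hstep : ∀ t ω, step t ω (sel t ω) = c t ω (sel t ω))
    (hc : ∀ t i, Measurable[ℱ t] fun ω => c t ω i) (hc0 : ∀ t ω i, 0 ≤ c t ω i)
    {B : ℕ → ℝ} (hB : ∀ t ω i, |c t ω i| ≤ B t) {C : ℝ}
    (hC : ∀ i N, ∑ t ∈ Finset.range N, ∫ ω, c t ω i ^ 2 ∂Pr ≤ C)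
    (hlim : ∀ i, ∀ᵐ ω ∂Pr, Tendsto (fun t => c t ω i) atTop (𝓝 0)) (i : S) :
    ∀ᵐ ω ∂Pr, ∃ K : ℝ, ∀ t, |J t ω i| ≤ K := by
  classical
  have h1 := ae_all_iff.2 fun π =>
    h.ae_exists_tendsto_sum_cost_noise hM (fun i => (hp i).le) hc hB hC π i
  have h2 := ae_all_iff.2 fun π => h.ae_exists_tendsto_sum_selection_noise (fun i => (hp i).le) π i
    (fun t => hc t i) (fun t ω => hB t ω i) (hC i)
  filter_upwards [h1, h2, hlim i] with ω h1 h2 hlim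
  -- On each policy this is the cost noise minus `J^π(i)` times the selection noise; no bound on `J`
  -- is needed yet.
  obtain ⟨l, hl⟩ := exists_tendsto_sum_policy (pol := fun t => pol t ω)
    (fun π t => if sel t ω = i then
      c t ω i * (M.observedCost π (traj t ω) - M.costToGo π i) else 0) (fun π => by
    obtain ⟨l1, hl1⟩ := h1 π
    obtain ⟨l2, hl2⟩ := h2 π
    refine ⟨l1 - M.costToGo π i * l2, (hl1.sub (hl2.const_mul _)).congr fun N => ?_⟩
    rw [Finset.mul_sum, ← Finset.sum_sub_distrib]
    refine Finset.sum_congr rfl fun t _ => ?_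
    by_cases hπ : pol t ω = π <;> by_cases hs : sel t ω = i <;>
      simp [sampled, hπ, hs] <;> ring)
  refine bounded_of_stochastic_approx (a := fun t => if sel t ω = i then c t ω i else 0)
    (b := fun t => M.costToGo (pol t ω) i) (C := ∑ π, |M.costToGo π i|) (fun t => ?_) ?_
    (fun t => ?_) hl fun t => ?_
  · split_ifs
    · exact hc0 t ω i
    · exact le_rfl
  · filter_upwards [hlim.eventually_le_const one_pos] with t ht
    split_ifs
    · exact ht
    · exact zero_le_one
  · rw [h.update]
    by_cases hs : sel t ω = i
    · have := hstep t ω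
      rw [hs] at this
      simp only [hs, if_true, this]
      ring
    · simp [hs]
  · exact Finset.single_le_sum (f := fun π => |M.costToGo π i|) (fun _ _ => abs_nonneg _)
      (Finset.mem_univ _)

/-- Convergence of MCES when the effective stepsizes `p i * c t ω i` of all the states are
asymptotically equivalent to a common deterministic sequence `γ`. -/
theorem ae_tendsto_optCost (h : M.IsMCES p Pr ℱ J pol sel traj step)
    (hM : ∀ π, M.IsProper π) (hp : ∀ i, 0 < p i)
    (hstep : ∀ t ω, step t ω (sel t ω) = c t ω (sel t ω))
    (hc : ∀ t i, Measurable[ℱ t] fun ω => c t ω i) (hc0 : ∀ t ω i, 0 ≤ c t ω i)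
    {B : ℕ → ℝ} (hB : ∀ t ω i, |c t ω i| ≤ B t) {C : ℝ}
    (hC : ∀ i N, ∑ t ∈ Finset.range N, ∫ ω, c t ω i ^ 2 ∂Pr ≤ C)
    {γ : ℕ → ℝ} (h0 : ∀ t, 0 ≤ γ t) (hγ0 : Tendsto γ atTop (𝓝 0))
    (hγ : Tendsto (fun N => ∑ t ∈ Finset.range N, γ t) atTop atTop)
    (hδ : ∀ i, ∀ᵐ ω ∂Pr, ∃ δ : ℕ → ℝ, Tendsto δ atTop (𝓝 0) ∧
      ∀ t, p i * c t ω i = γ t * (1 + δ t)) :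
    ∀ᵐ ω ∂Pr, Tendsto (fun t => J t ω) atTop (𝓝 M.optCost) := by
  classical
  have hlim : ∀ i, ∀ᵐ ω ∂Pr, Tendsto (fun t => c t ω i) atTop (𝓝 0) := fun i => by
    filter_upwards [hδ i] with ω ⟨δ, hδ0, hδe⟩
    have h1 : Tendsto (fun t => (p i)⁻¹ * (γ t * (1 + δ t))) atTop (𝓝 ((p i)⁻¹ * (0 * (1 + 0)))) :=
      (hγ0.mul (hδ0.const_add 1)).const_mul _
    rw [zero_mul, mul_zero] at h1
    refine h1.congr fun t => ?_
    rw [← hδe, inv_mul_cancel_left₀ (hp i).ne']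
  have h1 := ae_all_iff.2 fun π => ae_all_iff.2 fun i =>
    h.ae_exists_tendsto_sum_cost_noise hM (fun i => (hp i).le) hc hB hC π i
  -- The selection noise carries the coefficient `c * J`, whose moments are not controlled.
  -- Truncating `J` at every natural level `K` costs countably many null sets; on each bounded path
  -- some level makes the truncation inactive.
  have h2 := ae_all_iff.2 fun (K : ℕ) => ae_all_iff.2 fun π => ae_all_iff.2 fun i =>
    h.ae_exists_tendsto_sum_selection_noise (fun i => (hp i).le) π i
      (c := fun t ω => c t ω i * max (-(K : ℝ)) (min (J t ω i) K)) (B := fun t => B t * K)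
      (C := K ^ 2 * C)
      (fun t => (hc t i).mul (measurable_const.max
        ((h.measurable_value hstep hc t i).min measurable_const)))
      (fun t ω => by
        rw [abs_mul]
        refine mul_le_mul (hB t ω i) (abs_max_neg_min_le K.cast_nonneg _) (abs_nonneg _)
          ((abs_nonneg _).trans (hB t ω i)))
      (fun N => by
        refine le_trans ?_ (mul_le_mul_of_nonneg_left (hC i N) (sq_nonneg (K : ℝ)))
        rw [Finset.mul_sum]
        refine Finset.sum_le_sum fun t _ => ?_
        rw [← integral_const_mul]
        have hcsq : Integrable (fun ω => c t ω i ^ 2) Pr :=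
          Integrable.of_bound (C := B t ^ 2)
            (((hc t i).pow_const 2).mono (ℱ.le t) le_rfl).aestronglyMeasurable
            (ae_of_all _ fun ω => by
              rw [Real.norm_eq_abs, abs_pow]
              exact pow_le_pow_left₀ (abs_nonneg _) (hB t ω i) 2)
        refine integral_mono_of_nonneg (ae_of_all _ fun ω => sq_nonneg _) (hcsq.const_mul _)
          (ae_of_all _ fun ω => ?_)
        have hK : |max (-(K : ℝ)) (min (J t ω i) K)| ≤ K := abs_max_neg_min_le K.cast_nonneg _
        have h3 := pow_le_pow_left₀ (abs_nonneg _) hK 2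
        rw [sq_abs] at h3
        simp only [mul_pow]
        rw [mul_comm]
        exact mul_le_mul_of_nonneg_right h3 (sq_nonneg _))
  have h3 := ae_all_iff.2 fun i => h.ae_exists_bound hM hp hstep hc hc0 hB hC hlim i
  filter_upwards [h1, h2, h3, ae_all_iff.2 hδ] with ω h1 h2 h3 hδ
  choose δ hδ0 hδe using hδ
  choose b hb using h3
  obtain ⟨K, hK⟩ := exists_nat_ge (∑ i, |b i|)
  have hJK : ∀ t i, |J t ω i| ≤ K := fun t i => (hb i t).trans ((le_abs_self _).trans
    ((Finset.single_le_sum (f := fun i => |b i|) (fun _ _ => abs_nonneg _)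
      (Finset.mem_univ i)).trans hK))
  have htrunc : ∀ t i, max (-(K : ℝ)) (min (J t ω i) K) = J t ω i := fun t i => by
    rw [min_eq_left (abs_le.1 (hJK t i)).2, max_eq_right (abs_le.1 (hJK t i)).1]
  -- The mean increment is `p i * c * (J^μ - J) = γ * (1 + δ) * (J^μ - J)`: its `δ` part is `γ * r`,
  -- and `e` is the actual increment minus the mean one.
  refine M.tendsto_optCost_of_perturbed (γ := γ) (J := fun t => J t ω) (pol := fun t => pol t ω)
    (r := fun t i => δ i t * (M.costToGo (pol t ω) i - J t ω i))
    (e := fun t i => J (t + 1) ω i - J t ω i -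
      p i * c t ω i * (M.costToGo (pol t ω) i - J t ω i))
    hM h0 hγ0 hγ (fun t => h.greedy t ω) (fun i => ?_) (fun π i => ?_) (fun t => ?_)
  · have hbdd : ∀ t, |M.costToGo (pol t ω) i - J t ω i| ≤ (∑ π, |M.costToGo π i|) + K := fun t =>
      (abs_sub _ _).trans (add_le_add (Finset.single_le_sum (f := fun π => |M.costToGo π i|)
        (fun _ _ => abs_nonneg _) (Finset.mem_univ _)) (hJK t i))
    refine squeeze_zero_norm (a := fun t => |δ i t| * ((∑ π, |M.costToGo π i|) + K)) (fun t => ?_) ?_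
    · rw [Real.norm_eq_abs, abs_mul]
      exact mul_le_mul_of_nonneg_left (hbdd t) (abs_nonneg _)
    · simpa using (hδ0 i).abs.mul_const ((∑ π, |M.costToGo π i|) + K)
  · obtain ⟨l1, hl1⟩ := h1 π i
    obtain ⟨l2, hl2⟩ := h2 K π i
    -- `e` is the cost noise weighted by `c` minus the selection noise weighted by `c * J`.
    refine ⟨l1 - l2, (hl1.sub hl2).congr fun N => ?_⟩
    rw [← Finset.sum_sub_distrib]
    refine Finset.sum_congr rfl fun t _ => ?_
    simp only [htrunc]
    rw [h.update]
    by_cases hπ : pol t ω = π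
    · by_cases hs : sel t ω = i
      · have := hstep t ω
        rw [hs] at this
        simp [sampled, hπ, hs, this]
        ring
      · simp [sampled, hπ, hs]
        ring
    · simp [sampled, hπ]
  · funext i
    simp only [Pi.add_apply, Pi.smul_apply, smul_eq_mul, hδe]
    ring

end SSP.IsMCES

/-! ### Selection counts and the two stepsize rules. -/

theorem summable_one_div_nat_succ_sq : Summable fun n : ℕ => (1 / ((n : ℝ) + 1)) ^ 2 := by
  have h := (summable_nat_add_iff 1).2 (Real.summable_one_div_nat_pow.2 (one_lt_two))
  exact h.congr fun n => by push_cast; rw [div_pow, one_pow]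

namespace SSP

/-- The number of selections of the state `i` strictly before time `t`, as a real number. -/
def priorCount {S Ω : Type*} [DecidableEq S] (sel : ℕ → Ω → S) (t : ℕ) (ω : Ω) (i : S) : ℝ :=
  ∑ r ∈ Finset.range t, if sel r ω = i then 1 else 0

theorem priorCount_nonneg {S Ω : Type*} [DecidableEq S] (sel : ℕ → Ω → S) (t : ℕ) (ω : Ω) (i : S) :
    0 ≤ priorCount sel t ω i :=
  Finset.sum_nonneg fun _ _ => by split_ifs <;> norm_num

theorem priorCount_succ {S Ω : Type*} [DecidableEq S] (sel : ℕ → Ω → S) (t : ℕ) (ω : Ω) (i : S) :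
    priorCount sel (t + 1) ω i = priorCount sel t ω i + if sel t ω = i then 1 else 0 :=
  Finset.sum_range_succ _ _

theorem selectionCount_eq {S Ω : Type*} [DecidableEq S] (sel : ℕ → Ω → S) (t : ℕ) (ω : Ω) (i : S) :
    (selectionCount sel t ω i : ℝ) = priorCount sel (t + 1) ω i := by
  simp [selectionCount, priorCount]

/-- At the successive selections of `i` the prior count runs through `0, 1, 2, …`, so the left side
is a partial sum of the right. -/
theorem sum_selected_inv_sq_le {S Ω : Type*} [DecidableEq S] (sel : ℕ → Ω → S) (N : ℕ) (ω : Ω)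
    (i : S) : ∑ t ∈ Finset.range N, (if sel t ω = i then (1 / (priorCount sel t ω i + 1)) ^ 2 else 0)
      ≤ ∑' n : ℕ, (1 / ((n : ℝ) + 1)) ^ 2 := by
  have key : ∃ k : ℕ, priorCount sel N ω i = k ∧ ∑ t ∈ Finset.range N,
      (if sel t ω = i then (1 / (priorCount sel t ω i + 1)) ^ 2 else 0) =
        ∑ n ∈ Finset.range k, (1 / ((n : ℝ) + 1)) ^ 2 := by
    induction N with
    | zero => exact ⟨0, by simp [priorCount], by simp⟩
    | succ N ih =>
      obtain ⟨k, hk, hs⟩ := ih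
      by_cases h : sel N ω = i
      · exact ⟨k + 1, by rw [priorCount_succ, hk]; simp [h], by
          rw [Finset.sum_range_succ, hs, Finset.sum_range_succ, if_pos h, hk]⟩
      · exact ⟨k, by rw [priorCount_succ, hk]; simp [h], by
          rw [Finset.sum_range_succ, hs, if_neg h, add_zero]⟩
  obtain ⟨k, -, hs⟩ := key
  rw [hs]
  exact summable_one_div_nat_succ_sq.sum_le_tsum _ fun n _ => sq_nonneg _

namespace IsMCES
variable {S A Ω : Type*} [Fintype S] [DecidableEq S] {m : MeasurableSpace Ω}
  {M : SSP S A} {p : S → ℝ} {Pr : Measure Ω} {ℱ : Filtration ℕ m}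
  {J : ℕ → Ω → S → ℝ} {pol : ℕ → Ω → S → A} {sel : ℕ → Ω → S} {traj : ℕ → Ω → ℕ → Option S}
  {step : ℕ → Ω → S → ℝ}

theorem measurable_priorCount (h : M.IsMCES p Pr ℱ J pol sel traj step) (t : ℕ) (i : S) :
    Measurable[ℱ t] fun ω => priorCount sel t ω i :=
  Finset.measurable_fun_sum _ fun r hr => Measurable.ite
    (ℱ.mono (Nat.succ_le_of_lt (Finset.mem_range.1 hr)) _ (h.sel_measurable r i))
    measurable_const measurable_const

variable [Fintype A] [IsProbabilityMeasure Pr]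

theorem sum_sampled_one [DecidableEq A] (pol : ℕ → Ω → S → A) (sel : ℕ → Ω → S)
    (traj : ℕ → Ω → ℕ → Option S) (t : ℕ) (i : S) (ω : Ω) :
    ∑ π : S → A, sampled pol sel traj π i 1 t ω = if sel t ω = i then 1 else 0 := by
  by_cases hs : sel t ω = i <;> simp [sampled, Set.indicator, hs]

theorem condExp_selected (h : M.IsMCES p Pr ℱ J pol sel traj step) (hp : ∀ i, 0 ≤ p i)
    (t : ℕ) (i : S) :
    Pr[fun ω => if sel t ω = i then (1 : ℝ) else 0 | ℱ t] =ᵐ[Pr] fun _ => p i := by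
  classical
  have heq : (fun ω => if sel t ω = i then (1 : ℝ) else 0) =
      ∑ π : S → A, sampled pol sel traj π i 1 t := by
    funext ω
    rw [Finset.sum_apply, sum_sampled_one]
  have hint : ∀ π : S → A, Integrable (1 : (ℕ → Option S) → ℝ) (M.chainLaw π i) := fun π =>
    integrable_const 1
  rw [heq]
  refine (condExp_finsetSum (fun π _ => h.integrable_sampled π i (hint π) t) _).trans ?_
  filter_upwards [ae_all_iff.2 fun π => h.condExp_sampled hp π i (hint π) t] with ω hω
  rw [Finset.sum_apply]
  simp_rw [hω]
  simp [Set.indicator]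

theorem integral_selected_mul (h : M.IsMCES p Pr ℱ J pol sel traj step) (hp : ∀ i, 0 ≤ p i)
    (t : ℕ) (i : S) {f : Ω → ℝ} (hf : Measurable[ℱ t] f) {C : ℝ} (hC : ∀ ω, |f ω| ≤ C) :
    ∫ ω, (if sel t ω = i then f ω else 0) ∂Pr = p i * ∫ ω, f ω ∂Pr := by
  have hs : Integrable (fun ω => if sel t ω = i then (1 : ℝ) else 0) Pr :=
    Integrable.of_bound (C := 1) (Measurable.ite (ℱ.le _ _ (h.sel_measurable t i))
      measurable_const measurable_const).aestronglyMeasurable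
      (ae_of_all _ fun ω => by split_ifs <;> simp)
  have hprod : Integrable (f * fun ω => if sel t ω = i then (1 : ℝ) else 0) Pr :=
    hs.bdd_mul (c := C) (hf.mono (ℱ.le t) le_rfl).aestronglyMeasurable (ae_of_all _ hC)
  have heq : (fun ω => if sel t ω = i then f ω else 0) =
      f * fun ω => if sel t ω = i then (1 : ℝ) else 0 := by
    funext ω; simp
  rw [heq, ← integral_condExp (ℱ.le t), ← integral_const_mul]
  refine integral_congr_ae ((condExp_mul_of_stronglyMeasurable_left hf.stronglyMeasurable hprod
    hs).trans ?_)
  filter_upwards [h.condExp_selected hp t i] with ω hω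
  rw [Pi.mul_apply, hω, mul_comm]

/-- Law of large numbers, as stochastic approximation: the normalised count is averaged with
stepsize `1 / (t + 2)` towards the selection indicator, that is, `p i` plus selection noise. -/
theorem ae_tendsto_priorCount_div (h : M.IsMCES p Pr ℱ J pol sel traj step) (hp : ∀ i, 0 ≤ p i)
    (i : S) : ∀ᵐ ω ∂Pr, Tendsto (fun t : ℕ => (priorCount sel t ω i + 1) / (t + 1)) atTop
      (𝓝 (p i)) := by
  classical
  have hsum : Summable fun n : ℕ => (1 / ((n : ℝ) + 2)) ^ 2 :=
    ((summable_nat_add_iff 1).2 summable_one_div_nat_succ_sq).congr fun n => by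
      push_cast; ring_nf
  have hγ : Tendsto (fun N => ∑ t ∈ Finset.range N, 1 / ((t : ℝ) + 2)) atTop atTop :=
    (tendsto_sum_range_add_atTop Real.tendsto_sum_range_one_div_nat_succ_atTop 1).congr fun N =>
      Finset.sum_congr rfl fun t _ => by push_cast; ring_nf
  have hγ0 : Tendsto (fun t : ℕ => 1 / ((t : ℝ) + 2)) atTop (𝓝 0) := by
    have := (tendsto_one_div_add_atTop_nhds_zero_nat (𝕜 := ℝ)).comp (tendsto_add_atTop_nat 1)
    refine this.congr fun t => ?_
    simp only [Function.comp_apply]; push_cast; ring_nf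
  have h1 := ae_all_iff.2 fun π => h.ae_exists_tendsto_sum_selection_noise hp π i
    (c := fun t _ => 1 / ((t : ℝ) + 2)) (B := fun t => |1 / ((t : ℝ) + 2)|)
    (C := ∑' n : ℕ, (1 / ((n : ℝ) + 2)) ^ 2) (fun t => measurable_const) (fun t ω => le_rfl)
    (fun N => by simpa using hsum.sum_le_tsum (Finset.range N) fun n _ => sq_nonneg _)
  filter_upwards [h1] with ω h1
  choose l hl using h1
  have hnoise : Tendsto (fun N => ∑ t ∈ Finset.range N,
      1 / ((t : ℝ) + 2) * ((if sel t ω = i then 1 else 0) - p i)) atTop (𝓝 (∑ π, l π)) := by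
    refine (tendsto_finsetSum Finset.univ fun π _ => hl π).congr fun N => ?_
    rw [Finset.sum_comm]
    refine Finset.sum_congr rfl fun t _ => ?_
    rw [← Finset.mul_sum, Finset.sum_sub_distrib, sum_sampled_one]
    simp [Set.indicator]
  refine tendsto_of_stochastic_approx (γ := fun t : ℕ => 1 / ((t : ℝ) + 2)) (b := fun _ => p i)
    (fun t => by positivity) hγ0 hγ (fun t => ?_) hnoise tendsto_const_nhds
  have ht1 : (t : ℝ) + 1 ≠ 0 := by positivity
  have ht2 : (t : ℝ) + 2 ≠ 0 := by positivity
  have ht3 : (t : ℝ) + 1 + 1 = t + 2 := by ring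
  rw [priorCount_succ]
  push_cast
  rw [ht3]
  field_simp
  ring

variable [Nonempty A]

theorem ae_tendsto_optCost_of_harmonic
    (h : M.IsMCES p Pr ℱ J pol sel traj fun t ω i => 1 / (selectionCount sel t ω i : ℝ))
    (hM : ∀ π, M.IsProper π) (hp : ∀ i, 0 < p i) :
    ∀ᵐ ω ∂Pr, Tendsto (fun t => J t ω) atTop (𝓝 M.optCost) := by
  have hp0 : ∀ i, 0 ≤ p i := fun i => (hp i).le
  have hpos : ∀ t ω i, 0 < priorCount sel t ω i + 1 := fun t ω i => by
    linarith [priorCount_nonneg sel t ω i]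
  have hc0 : ∀ t ω i, 0 ≤ 1 / (priorCount sel t ω i + 1) := fun t ω i =>
    (one_div_pos.2 (hpos t ω i)).le
  have hc1 : ∀ t ω i, 1 / (priorCount sel t ω i + 1) ≤ 1 := fun t ω i =>
    (div_le_one (hpos t ω i)).2 (by linarith [priorCount_nonneg sel t ω i])
  have hcm : ∀ t i, Measurable[ℱ t] fun ω => 1 / (priorCount sel t ω i + 1) := fun t i =>
    measurable_const.div ((h.measurable_priorCount t i).add_const 1)
  have habs : ∀ t ω i, |1 / (priorCount sel t ω i + 1)| ≤ 1 := fun t ω i => by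
    rw [abs_of_nonneg (hc0 t ω i)]
    exact hc1 t ω i
  set Q : ℝ := ∑' n : ℕ, (1 / ((n : ℝ) + 1)) ^ 2 with hQ
  have hQ0 : 0 ≤ Q := tsum_nonneg fun n => sq_nonneg _
  refine h.ae_tendsto_optCost (c := fun t ω i => 1 / (priorCount sel t ω i + 1)) hM hp
    (fun t ω => ?_) hcm hc0 (B := fun _ => 1) habs (C := ∑ i, (p i)⁻¹ * Q) (fun i N => ?_)
    (γ := fun t => 1 / ((t : ℝ) + 1)) (fun t => by positivity)
    tendsto_one_div_add_atTop_nhds_zero_nat Real.tendsto_sum_range_one_div_nat_succ_atTop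
    fun i => ?_
  -- `n_i(t)` includes the current selection and is not `ℱ t`-measurable, but at the selected state
  -- it is the prior count plus one.
  · simp only [selectionCount_eq, priorCount_succ, if_true]
  · have hsel : ∀ t, Integrable (fun ω => if sel t ω = i then
        (1 / (priorCount sel t ω i + 1)) ^ 2 else 0) Pr := fun t =>
      Integrable.of_bound (C := 1) (Measurable.ite (ℱ.le _ _ (h.sel_measurable t i))
        (((hcm t i).pow_const 2).mono (ℱ.le t) le_rfl) measurable_const).aestronglyMeasurable
        (ae_of_all _ fun ω => by
          split_ifs
          · rw [Real.norm_eq_abs, abs_pow]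
            exact pow_le_one₀ (abs_nonneg _) (habs t ω i)
          · simp)
    -- The factor `p i` trades a sum over all times for a sum over selection times, which is bounded
    -- pathwise by `Q`.
    have hsum : p i * ∑ t ∈ Finset.range N, ∫ ω, (1 / (priorCount sel t ω i + 1)) ^ 2 ∂Pr ≤ Q := by
      calc p i * ∑ t ∈ Finset.range N, ∫ ω, (1 / (priorCount sel t ω i + 1)) ^ 2 ∂Pr
          = ∑ t ∈ Finset.range N, ∫ ω, (if sel t ω = i then
              (1 / (priorCount sel t ω i + 1)) ^ 2 else 0) ∂Pr := by
            rw [Finset.mul_sum]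
            refine Finset.sum_congr rfl fun t _ => ?_
            rw [h.integral_selected_mul hp0 t i ((hcm t i).pow_const 2) (C := 1) fun ω => ?_]
            rw [abs_pow]
            exact pow_le_one₀ (abs_nonneg _) (habs t ω i)
        _ = ∫ ω, ∑ t ∈ Finset.range N, (if sel t ω = i then
              (1 / (priorCount sel t ω i + 1)) ^ 2 else 0) ∂Pr :=
            (integral_finsetSum _ fun t _ => hsel t).symm
        _ ≤ ∫ _, Q ∂Pr := integral_mono (integrable_finsetSum _ fun t _ => hsel t)
            (integrable_const Q) fun ω => sum_selected_inv_sq_le sel N ω i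
        _ = Q := by simp
    calc ∑ t ∈ Finset.range N, ∫ ω, (1 / (priorCount sel t ω i + 1)) ^ 2 ∂Pr
        ≤ (p i)⁻¹ * Q := by
          rw [inv_mul_eq_div, le_div_iff₀ (hp i), mul_comm]
          exact hsum
      _ ≤ ∑ i, (p i)⁻¹ * Q := Finset.single_le_sum (f := fun i => (p i)⁻¹ * Q)
          (fun j _ => mul_nonneg (inv_nonneg.2 (hp0 j)) hQ0) (Finset.mem_univ i)
  · filter_upwards [h.ae_tendsto_priorCount_div hp0 i] with ω hω
    refine ⟨fun t => p i / ((priorCount sel t ω i + 1) / (t + 1)) - 1, ?_, fun t => ?_⟩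
    · have h1 := (tendsto_const_nhds (x := p i)).div hω (hp i).ne'
      rw [div_self (hp i).ne'] at h1
      simpa using h1.sub_const 1
    · have h1 := (hpos t ω i).ne'
      have h2 : (t : ℝ) + 1 ≠ 0 := by positivity
      field_simp
      ring

theorem ae_tendsto_optCost_of_deterministic {γ : ℕ → ℝ} (h0 : ∀ t, 0 ≤ γ t)
    (hγ : Tendsto (fun N => ∑ t ∈ Finset.range N, γ t) atTop atTop)
    (hγ2 : Summable fun t => γ t ^ 2)
    (h : M.IsMCES p Pr ℱ J pol sel traj fun t _ i => γ t / p i)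
    (hM : ∀ π, M.IsProper π) (hp : ∀ i, 0 < p i) :
    ∀ᵐ ω ∂Pr, Tendsto (fun t => J t ω) atTop (𝓝 M.optCost) := by
  have hγ0 : Tendsto γ atTop (𝓝 0) := by
    have := hγ2.tendsto_atTop_zero.sqrt
    rw [Real.sqrt_zero] at this
    exact this.congr fun t => Real.sqrt_sq (h0 t)
  refine h.ae_tendsto_optCost (c := fun t _ i => γ t / p i) hM hp (fun t ω => rfl)
    (fun t i => measurable_const) (fun t ω i => div_nonneg (h0 t) (hp i).le)
    (B := fun t => ∑ i, |γ t / p i|) (fun t ω i => Finset.single_le_sum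
      (f := fun i => |γ t / p i|) (fun _ _ => abs_nonneg _) (Finset.mem_univ i))
    (C := ∑ i, (∑' t, γ t ^ 2) / p i ^ 2) (fun i N => ?_) h0 hγ0 hγ fun i => ae_of_all _ fun ω =>
      ⟨fun _ => 0, tendsto_const_nhds, fun t => ?_⟩
  · calc ∑ t ∈ Finset.range N, ∫ _, (γ t / p i) ^ 2 ∂Pr
        = (∑ t ∈ Finset.range N, γ t ^ 2) / p i ^ 2 := by
          simp [div_pow, Finset.sum_div]
      _ ≤ (∑' t, γ t ^ 2) / p i ^ 2 := div_le_div_of_nonneg_right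
          (hγ2.sum_le_tsum _ fun t _ => sq_nonneg _) (sq_nonneg _)
      _ ≤ _ := Finset.single_le_sum (f := fun i => (∑' t, γ t ^ 2) / p i ^ 2)
          (fun j _ => div_nonneg (tsum_nonneg fun t => sq_nonneg _) (sq_nonneg _))
          (Finset.mem_univ i)
  · have := (hp i).ne'
    field_simp
    ring

end IsMCES

theorem nonempty_actions {S A Ω : Type*} [Nonempty S] [Nonempty Ω] (pol : ℕ → Ω → S → A) :
    Nonempty A :=
  ⟨pol 0 (Classical.arbitrary Ω) (Classical.arbitrary S)⟩

end SSP

theorem mainTheorem2 {S A Ω : Type*} [Fintype S] [DecidableEq S] [Fintype A]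
    {m : MeasurableSpace Ω} (Pr : Measure Ω) [IsProbabilityMeasure Pr] (ℱ : Filtration ℕ m)
    (M : SSP S A) (hproper : ∀ π : S → A, M.IsProper π)
    (p : S → ℝ) (hp_pos : ∀ i, 0 < p i) (hp_sum : ∑ i, p i = 1)
    (J : ℕ → Ω → S → ℝ) (pol : ℕ → Ω → S → A) (sel : ℕ → Ω → S)
    (traj : ℕ → Ω → ℕ → Option S) :
    (M.IsMCES p Pr ℱ J pol sel traj
        (fun t ω i => 1 / (SSP.selectionCount sel t ω i : ℝ)) →
      ∀ᵐ ω ∂Pr, Tendsto (fun t => J t ω) atTop (𝓝 M.optCost)) ∧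
    (∀ γ : ℕ → ℝ, (∀ t, 0 ≤ γ t) →
      Tendsto (fun N => ∑ t ∈ Finset.range N, γ t) atTop atTop →
      Summable (fun t => γ t ^ 2) →
      M.IsMCES p Pr ℱ J pol sel traj (fun t _ i => γ t / p i) →
      ∀ᵐ ω ∂Pr, Tendsto (fun t => J t ω) atTop (𝓝 M.optCost)) := by
  -- The weights sum to `1`, so `S` is nonempty; any value of `pol` then supplies an action.
  have hS : Nonempty S := by
    by_contra hS
    rw [not_nonempty_iff] at hS
    simp at hp_sum
  have hΩ : Nonempty Ω := nonempty_of_isProbabilityMeasure Pr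
  have hA : Nonempty A := SSP.nonempty_actions pol
  exact ⟨fun h => h.ae_tendsto_optCost_of_harmonic hproper hp_pos,
    fun γ h0 hγ hγ2 h => h.ae_tendsto_optCost_of_deterministic h0 hγ hγ2 hproper hp_pos⟩
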